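/- Conventions. A *topological ring* is a commutative ring with a linear topology that admits a countable fundamental system of open neighbourhoods of $0$ consisting of ideals; it is *complete* if it is Hausdorff and complete, i.e. the limit of its discrete quotients by open ideals. For such a ring $\mathcal A$, $\mathrm{Spf}(\mathcal A)$ is the topologically ringed space whose points are the open prime ideals of $\mathcal A$ (with the Zariski topology) and whose structure sheaf sends $U$ to $\varprojlim_{\mathfrak a}\Gamma\big(U\cap\mathrm{Spec}(\mathcal A/\mathfrak a),\mathcal O_{\mathrm{Spec}(\mathcal A/\mathfrak a)}\big)$ ($\mathfrak a$ running through the open ideals; limit of discrete rings). Affine ind-schemes are the spaces $\mathrm{Spf}(\mathcal A)$, and morphisms between them are the morphisms of topologically ringed spaces induced by continuous ring homomorphisms; the homomorphism inducing $f$ is denoted $f^\sharp$. Let $\mathcal A$ be a complete topological ring, $\varphi\colon\mathcal A\to\mathcal B$ a complete topological $\mathcal A$-algebra (i.e. $\mathcal B$ is a complete topological ring and $\varphi$ is a continuous ring homomorphism), and $\mathfrak X=\mathrm{Spf}(\mathcal B)\to\mathfrak S=\mathrm{Spf}(\mathcal A)$ the corresponding morphism. Fibre products over $\mathfrak S$ are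 taken in affine ind-schemes: $\mathrm{Spf}(\mathcal C)\,\widehat\times_{\mathfrak S}\,\mathrm{Spf}(\mathcal C')=\mathrm{Spf}(\mathcal C\,\widehat\otimes_{\mathcal A}\,\mathcal C')$, where $\mathcal C\,\widehat\otimes_{\mathcal A}\,\mathcal C'$ is the separated completion of $\mathcal C\otimes_{\mathcal A}\mathcal C'$ for the topology defined by the ideals generated by $\mathfrak c\otimes 1$ and $1\otimes\mathfrak c'$ ($\mathfrak c,\mathfrak c'$ open ideals). Let $\mathcal A\{T\}$ be the separated completion of $\mathcal A[T]$ for the topology defined by the ideals $\mathfrak a[T]$ ($\mathfrak a$ an open ideal of $\mathcal A$), and let $\mathbb G_{a,\mathfrak S}=\mathrm{Spf}(\mathcal A\{T\})$ be the additive group ind-scheme over $\mathfrak S$, with group law $m$ given by $m^\sharp(T)=T\otimes 1+1\otimes T$ and zero section given by $T\mapsto 0$. An *action* of $\mathbb G_{a,\mathfrak S}$ on $\mathfrak X$ is a morphism $\mu\colon\mathbb G_{a,\mathfrak S}\,\widehat\times_{\mathfrak S}\,\mathfrak X\to\mathfrak X$ over $\mathfrak S$ satisfying the usual associativity and unit axioms.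 A sequence of homomorphisms $f_n\colon G\to G'$ of topological abelian groups *converges continuously* to a homomorphism $f$ if every $f_n$ is continuous and for every $g\in G$ and every open subgroup $H'\subset G'$ there are an open subgroup $H\subset G$ and an index $n_0$ such that $f_n(g+h)-f(g+h)\in H'$ for all $h\in H$ and $n\ge n_0$. A *topologically integrable iterated higher $\mathcal A$-derivation* of $\mathcal B$ is a family $D=\{D^{(i)}\}_{i\ge0}$ of continuous $\mathcal A$-linear maps $\mathcal B\to\mathcal B$ such that $D^{(0)}=\mathrm{id}$, $D^{(i)}(bb')=\sum_{j=0}^iD^{(j)}(b)D^{(i-j)}(b')$, $D^{(i)}\circ D^{(j)}=\binom{i+j}{i}D^{(i+j)}$, and $(D^{(i)})_{i}$ converges continuously to $0$. **Theorem.** (1) Actions $\mu$ of $\mathbb G_{a,\mathfrak S}$ on $\mathfrak X$ are in one-to-one correspondence with topologically integrable iterated higher $\mathcal A$-derivations $D$ of $\mathcal B$. In this correspondence $$\mu^\sharp(b)=\sum_{i\ge0}\mathrm{pr}_2^\sharp\big(D^{(i)}(b)\big)\,\mathrm{pr}_1^\sharp(T)^i\qquad(b\in\mathcal B),$$ a convergent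 sum in $\mathcal A\{T\}\,\widehat\otimes_{\mathcal A}\,\mathcal B$, where $\mathrm{pr}_1,\mathrm{pr}_2$ are the projections of $\mathbb G_{a,\mathfrak S}\,\widehat\times_{\mathfrak S}\,\mathfrak X$. (2) If $\mathcal A$ is a $\mathbb Q$-algebra, then $D\mapsto\partial=D^{(1)}$ is a bijection from topologically integrable iterated higher $\mathcal A$-derivations of $\mathcal B$ to topologically integrable $\mathcal A$-derivations of $\mathcal B$, i.e. continuous $\mathcal A$-derivations $\partial\colon\mathcal B\to\mathcal B$ whose sequence of iterates $(\partial^n)_n$ converges continuously to $0$; moreover $D^{(n)}=\frac1{n!}\partial^n$ for all $n\ge0$. -/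

import Mathlib

open CategoryTheory Topology TopologicalSpace Opposite

universe u

/-- A complete topological ring: a commutative ring with a linear topology (given by ideals),
separated, complete, with a countable fundamental system of neighbourhoods of `0`. -/
class CompleteTopRing (A : Type u) [CommRing A] [UniformSpace A] : Prop extends
    IsUniformAddGroup A, IsTopologicalRing A, IsLinearTopology A A, CompleteSpace A,
    T2Space A where
  countable_basis : (𝓝 (0 : A)).IsCountablyGenerated

/-- A (not necessarily separated) linear topology on a commutative ring `R`, given by a
fundamental system of open ideals which has a countable cofinal subsystem. -/
structure IdealSystem (R : Type u) [CommRing R] where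
  ι : Type u
  ideal : ι → Ideal R
  exists_seq : ∃ s : ℕ → ι, ∀ i, ∃ N, ∀ n ≥ N, ideal (s n) ≤ ideal i

namespace IdealSystem

variable {R : Type u} [CommRing R] (F : IdealSystem R)

lemma exists_le_finite (s : Set F.ι) (hs : s.Finite) : ∃ k, ∀ i ∈ s, F.ideal k ≤ F.ideal i := by
  obtain ⟨t, ht⟩ := F.exists_seq
  choose N hN using ht
  obtain ⟨M, hM⟩ := (hs.image N).bddAbove
  exact ⟨t M, fun i hi => hN i M (hM ⟨i, hi, rfl⟩)⟩

lemma exists_le_pair (i j : F.ι) : ∃ k, F.ideal k ≤ F.ideal i ∧ F.ideal k ≤ F.ideal j := by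
  obtain ⟨k, hk⟩ := F.exists_le_finite {i, j} (Set.toFinite _)
  exact ⟨k, hk i (by simp), hk j (by simp)⟩

/-- The inverse limit `lim R ⧸ 𝔞` as a subring of the product. -/
def limSubring : Subring (∀ i, R ⧸ F.ideal i) where
  carrier := {x | ∀ i j (h : F.ideal i ≤ F.ideal j), Ideal.Quotient.factor h (x i) = x j}
  mul_mem' ha hb i j h := by simp [ha i j h, hb i j h]
  one_mem' i j h := by simp
  add_mem' ha hb i j h := by simp [ha i j h, hb i j h]
  zero_mem' i j h := by simp
  neg_mem' ha i j h := by simp [ha i j h]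

/-- The separated completion `lim R ⧸ 𝔞` of `R` for the linear topology defined by `F`. -/
def Compl : Type u := F.limSubring

noncomputable instance : CommRing F.Compl := inferInstanceAs (CommRing F.limSubring)

/-- The projection of the separated completion to `R ⧸ 𝔞`. -/
noncomputable def proj (i : F.ι) : F.Compl →+* R ⧸ F.ideal i :=
  (Pi.evalRingHom _ i).comp F.limSubring.subtype

/-- The canonical map to the separated completion. -/
noncomputable def of : R →+* F.Compl :=
  (RingHom.pi fun i => Ideal.Quotient.mk (F.ideal i)).codRestrict F.limSubring
    (fun _ _ _ _ => rfl)

@[simp] lemma proj_of (i : F.ι) (r : R) : F.proj i (F.of r) = Ideal.Quotient.mk _ r := rfl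

@[ext] lemma ext {x y : F.Compl} (h : ∀ i, F.proj i x = F.proj i y) : x = y :=
  Subtype.ext (funext h)

lemma factor_proj {i j : F.ι} (h : F.ideal i ≤ F.ideal j) (x : F.Compl) :
    Ideal.Quotient.factor h (F.proj i x) = F.proj j x := x.2 i j h

/-- The inverse limit topology (as a uniform structure), each `R ⧸ 𝔞` being discrete. -/
instance : UniformSpace F.Compl :=
  UniformSpace.comap (fun x : F.Compl => (x.1 : ∀ i, R ⧸ F.ideal i))
    (@Pi.uniformSpace _ _ (fun _ => ⊥))

lemma continuous_proj (i : F.ι) : @Continuous _ _ _ ⊥ (F.proj i) := by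
  let : ∀ i, UniformSpace (R ⧸ F.ideal i) := fun _ => ⊥
  have h : Continuous (fun x : F.Compl => (x.1 : ∀ i, R ⧸ F.ideal i)) := continuous_induced_dom
  exact (continuous_apply i).comp h

lemma nhds_zero_hasBasis :
    (𝓝 (0 : F.Compl)).HasBasis (fun _ : F.ι => True) (fun i => {x | F.proj i x = 0}) := by
  let : ∀ i, UniformSpace (R ⧸ F.ideal i) := fun _ => ⊥
  have : ∀ i, DiscreteTopology (R ⧸ F.ideal i) := fun _ => ⟨rfl⟩
  refine ⟨fun t => ?_⟩
  have h0 : 𝓝 (0 : F.Compl) = Filter.comap (fun x : F.Compl => (x.1 : ∀ i, R ⧸ F.ideal i))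
      (𝓝 0) := nhds_induced _ _
  constructor
  · intro ht
    rw [h0, Filter.mem_comap] at ht
    obtain ⟨v, hv, hvt⟩ := ht
    rw [nhds_pi, Filter.mem_pi] at hv
    obtain ⟨I, hI, s, hs, hsv⟩ := hv
    obtain ⟨k, hk⟩ := F.exists_le_finite I hI
    refine ⟨k, trivial, fun x hx => hvt (hsv fun i hi => ?_)⟩
    have : F.proj i x = 0 := by
      rw [← F.factor_proj (hk i hi), show F.proj k x = 0 from hx, map_zero]
    have h2 : (x.1 i) = 0 := this
    simp only [h2]
    exact mem_of_mem_nhds (hs i)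
  · rintro ⟨i, -, hi⟩
    refine Filter.mem_of_superset ?_ hi
    have := (F.continuous_proj i).continuousAt (x := 0)
    have h3 : ({0} : Set (R ⧸ F.ideal i)) ∈ 𝓝 (F.proj i 0) := by
      rw [map_zero, nhds_discrete]; rfl
    exact this h3

instance : CompleteTopRing F.Compl := by
  let : ∀ i, UniformSpace (R ⧸ F.ideal i) := fun _ => ⊥
  have : ∀ i, DiscreteTopology (R ⧸ F.ideal i) := fun _ => ⟨rfl⟩
  have hui : IsUniformInducing (fun x : F.Compl => (x.1 : ∀ i, R ⧸ F.ideal i)) := ⟨rfl⟩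
  have i1 : IsUniformAddGroup F.Compl :=
    IsUniformAddGroup.comap (F.limSubring.subtype : F.limSubring →+* _)
  have i2 : IsTopologicalRing F.Compl := inferInstanceAs (IsTopologicalRing F.limSubring)
  have i3 : IsLinearTopology F.Compl F.Compl :=
    IsLinearTopology.mk_of_hasBasis (ι := F.ι) (S := Ideal F.Compl) F.Compl
      (s := fun i => RingHom.ker (F.proj i)) F.nhds_zero_hasBasis
  have i4 : CompleteSpace F.Compl := by
    rw [completeSpace_iff_isComplete_range hui]
    have hr : Set.range (fun x : F.Compl => (x.1 : ∀ i, R ⧸ F.ideal i)) =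
        {x | ∀ i j (h : F.ideal i ≤ F.ideal j), Ideal.Quotient.factor h (x i) = x j} :=
      Subtype.range_coe
    rw [hr]
    refine IsClosed.isComplete ?_
    simp only [Set.ofPred_forall]
    refine isClosed_iInter fun i => isClosed_iInter fun j => isClosed_iInter fun h => ?_
    exact isClosed_eq ((continuous_of_discreteTopology).comp (continuous_apply i))
      (continuous_apply j)
  have i5 : T2Space F.Compl :=
    T2Space.of_injective_continuous Subtype.val_injective hui.uniformContinuous.continuous
  refine { i1, i2, i3, i4, i5 with countable_basis := ?_ }
  obtain ⟨s, hs⟩ := F.exists_seq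
  refine Filter.HasBasis.isCountablyGenerated (ι := ℕ) (p := fun _ => True)
    (s := fun n => {x | F.proj (s n) x = 0}) ?_
  refine F.nhds_zero_hasBasis.to_hasBasis (fun i _ => ?_) (fun n _ => ⟨s n, trivial, le_rfl⟩)
  obtain ⟨N, hN⟩ := hs i
  refine ⟨N, trivial, fun x hx => ?_⟩
  show F.proj i x = 0
  rw [← F.factor_proj (hN N le_rfl), show F.proj (s N) x = 0 from hx, map_zero]

lemma hasBasis_nhds (x : F.Compl) :
    (𝓝 x).HasBasis (fun _ : F.ι => True) (fun i => {y | F.proj i y = F.proj i x}) := by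
  have h := F.nhds_zero_hasBasis.comap (fun y => y - x)
  rw [nhds_translation_sub] at h
  simpa [sub_eq_zero] using h

lemma denseRange_of : DenseRange F.of := by
  intro x
  rw [mem_closure_iff_nhds_basis (F.hasBasis_nhds x)]
  intro i _
  obtain ⟨r, hr⟩ := Ideal.Quotient.mk_surjective (F.proj i x)
  exact ⟨F.of r, ⟨r, rfl⟩, hr⟩

section lift

variable {C : Type u} [CommRing C] [UniformSpace C] [CompleteTopRing C]

/-- Continuity of a ring homomorphism for the linear topology defined by `F`. -/
def IsCont (f : R →+* C) : Prop :=
  ∀ K : Ideal C, IsOpen (K : Set C) → ∃ i, F.ideal i ≤ K.comap f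

variable {F}

/-- The universal property of the separated completion. -/
lemma existsUnique_lift (f : R →+* C) (hf : F.IsCont f) :
    ∃! g : F.Compl →+* C, Continuous g ∧ ∀ r, g (F.of r) = f r := by
  let : UniformSpace R := UniformSpace.comap F.of inferInstance
  have hi : IsUniformInducing F.of := ⟨rfl⟩
  have : IsUniformAddGroup R := IsUniformAddGroup.comap F.of
  have hR : (𝓝 (0 : R)).HasBasis (fun _ : F.ι => True) (fun i => (F.ideal i : Set R)) := by
    have h0 : 𝓝 (0 : R) = Filter.comap F.of (𝓝 0) := by
      rw [hi.isInducing.nhds_eq_comap, map_zero]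
    rw [h0]
    convert F.nhds_zero_hasBasis.comap F.of using 2 with i
    ext r
    exact Ideal.Quotient.eq_zero_iff_mem.symm
  have hfc : UniformContinuous f := by
    refine uniformContinuous_of_tendsto_zero (f := f.toAddMonoidHom) ?_
    rw [hR.tendsto_iff (IsLinearTopology.hasBasis_open_ideal (R := C))]
    intro K hK
    obtain ⟨i, hi⟩ := hf K hK
    exact ⟨i, trivial, fun r hr => hi hr⟩
  refine ⟨IsDenseInducing.extendRingHom hi F.denseRange_of hfc, ⟨?_, ?_⟩, ?_⟩
  · exact (uniformContinuous_uniformly_extend hi F.denseRange_of hfc).continuous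
  · intro r
    exact IsDenseInducing.extend_eq (hi.isDenseInducing F.denseRange_of) hfc.continuous r
  · rintro g ⟨hg, hgr⟩
    refine DFunLike.coe_injective (F.denseRange_of.equalizer hg
      (uniformContinuous_uniformly_extend hi F.denseRange_of hfc).continuous (funext fun r => ?_))
    exact (hgr r).trans
      (IsDenseInducing.extend_eq (hi.isDenseInducing F.denseRange_of) hfc.continuous r).symm

/-- The continuous extension of a continuous ring homomorphism to the separated completion. -/
noncomputable def lift (f : R →+* C) (hf : F.IsCont f) : F.Compl →+* C :=
  (existsUnique_lift f hf).choose

lemma continuous_lift (f : R →+* C) (hf : F.IsCont f) : Continuous (lift f hf) :=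
  (existsUnique_lift f hf).choose_spec.1.1

@[simp] lemma lift_of (f : R →+* C) (hf : F.IsCont f) (r : R) : lift f hf (F.of r) = f r :=
  (existsUnique_lift f hf).choose_spec.1.2 r

lemma hom_ext {g₁ g₂ : F.Compl →+* C} (h₁ : Continuous g₁) (h₂ : Continuous g₂)
    (h : g₁.comp F.of = g₂.comp F.of) : g₁ = g₂ :=
  DFunLike.coe_injective (F.denseRange_of.equalizer h₁ h₂
    (funext fun r => DFunLike.congr_fun h r))

end lift

end IdealSystem

/-- The open ideals of a topological ring. -/
structure OpenIdeal (A : Type u) [CommRing A] [UniformSpace A] : Type u where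
  ideal : Ideal A
  isOpen : IsOpen (ideal : Set A)

namespace OpenIdeal

variable {A : Type u} [CommRing A] [UniformSpace A]

/-- Every complete topological ring has a countable decreasing fundamental system of open ideals. -/
lemma exists_seq [CompleteTopRing A] :
    ∃ s : ℕ → OpenIdeal A, ∀ I : OpenIdeal A, ∃ N, ∀ n ≥ N, (s n).1 ≤ I.1 := by
  have := CompleteTopRing.countable_basis (A := A)
  obtain ⟨x, hx⟩ := (𝓝 (0 : A)).exists_antitone_basis
  have h : ∀ n, ∃ I : OpenIdeal A, (I.1 : Set A) ⊆ x n := fun n => by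
    obtain ⟨I, hI, hIx⟩ := (IsLinearTopology.hasBasis_open_ideal (R := A)).mem_iff.1
      (hx.1.mem_of_mem (i := n) trivial)
    exact ⟨⟨I, hI⟩, hIx⟩
  choose s hs using h
  refine ⟨s, fun I => ?_⟩
  obtain ⟨N, -, hN⟩ := hx.1.mem_iff.1 (I.2.mem_nhds (zero_mem I.1))
  exact ⟨N, fun n hn => (hs n).trans ((hx.2 hn).trans hN)⟩

lemma eq_zero_of_forall_mem [CompleteTopRing A] {a : A} (h : ∀ I : OpenIdeal A, a ∈ I.1) :
    a = 0 := by
  by_contra ha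
  obtain ⟨I, hI, hIa⟩ := (IsLinearTopology.hasBasis_open_ideal (R := A)).mem_iff.1
    (isOpen_compl_singleton (x := a) |>.mem_nhds (Ne.symm ha))
  exact hIa (h ⟨I, hI⟩) rfl

end OpenIdeal

open AlgebraicGeometry in
/-- A topologically ringed space: a presheaf of topological rings whose underlying presheaf of
rings is a sheaf. -/
structure TopRingedSpace extends PresheafedSpace.{_, _, u} TopCommRingCat.{u} where
  isSheaf : TopCat.Presheaf.IsSheaf (presheaf ⋙ forget₂ TopCommRingCat.{u} CommRingCat.{u})

/-- Morphisms of topologically ringed spaces: a continuous map `f : X → Y` together with a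
morphism `𝒪_Y ⟶ f_* 𝒪_X` of presheaves of topological rings. -/
instance : Category TopRingedSpace.{u} :=
  inferInstanceAs (Category (InducedCategory _ TopRingedSpace.toPresheafedSpace))

namespace Spf

open AlgebraicGeometry

section Space

variable (A : Type u) [CommRing A] [UniformSpace A] [CompleteTopRing A]

/-- The underlying space of `Spf A`: the open prime ideals with the Zariski topology. -/
def space : TopCat.{u} := TopCat.of {p : PrimeSpectrum A // IsOpen (p.asIdeal : Set A)}

variable {A}

/-- The map `Spec (A ⧸ I) → Spf A`, for an open ideal `I`. -/
def incl (I : OpenIdeal A) : C(PrimeSpectrum (A ⧸ I.1), space A) where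
  toFun q := ⟨PrimeSpectrum.comap (Ideal.Quotient.mk I.1) q,
    AddSubgroup.isOpen_mono (H₁ := I.1.toAddSubgroup)
      (H₂ := (PrimeSpectrum.comap (Ideal.Quotient.mk I.1) q).asIdeal.toAddSubgroup)
      (fun x hx => by
        change Ideal.Quotient.mk I.1 x ∈ q.asIdeal
        rw [Ideal.Quotient.eq_zero_iff_mem.2 hx]; exact zero_mem _) I.2⟩
  continuous_toFun := (PrimeSpectrum.continuous_comap _).subtype_mk _

/-- The inverse image of an open subset of `Spf A` in `Spec (A ⧸ I)`. -/
def pre (I : OpenIdeal A) (U : Opens (space A)) : Opens (PrimeSpectrum.Top (A ⧸ I.1)) :=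
  Opens.comap (incl I) U

lemma mem_pre {I : OpenIdeal A} {U : Opens (space A)} {q : PrimeSpectrum.Top (A ⧸ I.1)} :
    q ∈ pre I U ↔ incl I q ∈ U := Iff.rfl

lemma pre_mono (I : OpenIdeal A) {U V : Opens (space A)} (h : U ≤ V) : pre I U ≤ pre I V :=
  fun _ hq => h hq

lemma incl_comap_factor {I J : OpenIdeal A} (h : I.1 ≤ J.1) (q : PrimeSpectrum (A ⧸ J.1)) :
    incl I (PrimeSpectrum.comap (Ideal.Quotient.factor h) q) = incl J q :=
  Subtype.ext (PrimeSpectrum.ext (Ideal.ext fun _ => Iff.rfl))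

/-- The map `𝒪_{Spec (A ⧸ I)} (U ∩ Spec (A ⧸ I)) → 𝒪_{Spec (A ⧸ J)} (U ∩ Spec (A ⧸ J))` of restriction
to a closed subscheme. -/
noncomputable def transition {I J : OpenIdeal A} (h : I.1 ≤ J.1) (U : Opens (space A)) :
    (Spec.structureSheaf (A ⧸ I.1)).1.obj (op (pre I U)) →+*
      (Spec.structureSheaf (A ⧸ J.1)).1.obj (op (pre J U)) :=
  StructureSheaf.comap (Ideal.Quotient.factor h) (pre I U) (pre J U) fun q hq => by
    exact (congrArg (fun p => p ∈ U) (incl_comap_factor h q)).mpr hq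

/-- The sections of the structure sheaf of `Spf A` on `U`, namely the limit over the open ideals
`I` of `A` of the rings of sections of `Spec (A ⧸ I)` on the inverse image of `U`. -/
noncomputable def sectionsSubring (U : Opens (space A)) :
    Subring (∀ I : OpenIdeal A, (Spec.structureSheaf (A ⧸ I.1)).1.obj (op (pre I U))) where
  carrier := {s | ∀ (I J : OpenIdeal A) (h : I.1 ≤ J.1), transition h U (s I) = s J}
  mul_mem' ha hb I J h := by simp [ha I J h, hb I J h]
  one_mem' I J h := by simp
  add_mem' ha hb I J h := by simp [ha I J h, hb I J h]
  zero_mem' I J h := by simp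
  neg_mem' ha I J h := by simp [ha I J h]

/-- See `Spf.sectionsSubring`. -/
def Sections (U : Opens (space A)) : Type u := sectionsSubring U

noncomputable instance (U : Opens (space A)) : CommRing (Sections U) :=
  inferInstanceAs (CommRing (sectionsSubring U))

/-- The component of a section at an open ideal. -/
noncomputable def component {U : Opens (space A)} (I : OpenIdeal A) :
    Sections U →+* (Spec.structureSheaf (A ⧸ I.1)).1.obj (op (pre I U)) :=
  (Pi.evalRingHom _ I).comp (sectionsSubring U).subtype

@[ext] lemma Sections.ext {U : Opens (space A)} {s t : Sections U}
    (h : ∀ I, component I s = component I t) : s = t := Subtype.ext (funext h)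

lemma transition_component {U : Opens (space A)} {I J : OpenIdeal A} (h : I.1 ≤ J.1)
    (s : Sections U) : transition h U (component I s) = component J s := s.2 I J h

/-- The inverse limit topology, each ring `𝒪_{Spec (A ⧸ I)} (U ∩ Spec (A ⧸ I))` being discrete. -/
instance (U : Opens (space A)) : TopologicalSpace (Sections U) :=
  TopologicalSpace.induced (fun s : Sections U => s.1) (@Pi.topologicalSpace _ _ (fun _ => ⊥))

instance (U : Opens (space A)) : IsTopologicalRing (Sections U) := by
  let : ∀ I : OpenIdeal A, TopologicalSpace
    ((Spec.structureSheaf (A ⧸ I.1)).1.obj (op (pre I U))) := fun _ => ⊥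
  have : ∀ I : OpenIdeal A, DiscreteTopology
    ((Spec.structureSheaf (A ⧸ I.1)).1.obj (op (pre I U))) := fun _ => ⟨rfl⟩
  exact inferInstanceAs (IsTopologicalRing (sectionsSubring U))

lemma continuous_component {U : Opens (space A)} (I : OpenIdeal A) :
    @Continuous _ _ _ ⊥ (component (U := U) I) := by
  let : ∀ I : OpenIdeal A, TopologicalSpace
    ((Spec.structureSheaf (A ⧸ I.1)).1.obj (op (pre I U))) := fun _ => ⊥
  exact (continuous_apply I).comp
    (continuous_induced_dom (f := fun s : Sections U => s.1))

/-- A map to a ring of sections is continuous if all its components are continuous for the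
discrete topologies. -/
lemma continuous_of_component {X : Type*} [TopologicalSpace X] {U : Opens (space A)}
    {f : X → Sections U} (h : ∀ I, @Continuous _ _ _ ⊥ (fun x => component I (f x))) :
    Continuous f := by
  let : ∀ I : OpenIdeal A, TopologicalSpace
    ((Spec.structureSheaf (A ⧸ I.1)).1.obj (op (pre I U))) := fun _ => ⊥
  exact continuous_induced_rng.2 (continuous_pi h)

lemma comap_congr {R S : Type u} [CommRing R] [CommRing S] {f g : R →+* S} (hfg : f = g)
    {U : Opens (PrimeSpectrum.Top R)} {V : Opens (PrimeSpectrum.Top S)}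
    (hf : V.1 ⊆ PrimeSpectrum.comap f ⁻¹' U.1) (hg : V.1 ⊆ PrimeSpectrum.comap g ⁻¹' U.1) :
    StructureSheaf.comap f U V hf = StructureSheaf.comap g U V hg := by
  subst hfg; rfl

lemma comap_comp_apply {R S P : Type u} [CommRing R] [CommRing S] [CommRing P] (f : R →+* S)
    (g : S →+* P) (k : R →+* P) (hk : g.comp f = k) {U : Opens (PrimeSpectrum.Top R)}
    {V : Opens (PrimeSpectrum.Top S)} {W : Opens (PrimeSpectrum.Top P)}
    (hUV : V.1 ⊆ PrimeSpectrum.comap f ⁻¹' U.1) (hVW : W.1 ⊆ PrimeSpectrum.comap g ⁻¹' V.1)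
    (hUW : W.1 ⊆ PrimeSpectrum.comap k ⁻¹' U.1)
    (s : (Spec.structureSheaf R).1.obj (op U)) :
    StructureSheaf.comap g V W hVW (StructureSheaf.comap f U V hUV s) =
      StructureSheaf.comap k U W hUW s := by
  subst hk
  exact (DFunLike.congr_fun (StructureSheaf.comap_comp f g U V W hUV hVW) s).symm

/-- Restriction of sections of the structure sheaf of an affine scheme. -/
noncomputable def resSpec {R : Type u} [CommRing R] {U V : Opens (PrimeSpectrum.Top R)}
    (h : V ≤ U) :
    (Spec.structureSheaf R).1.obj (op U) →+* (Spec.structureSheaf R).1.obj (op V) :=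
  ((Spec.structureSheaf R).1.map (homOfLE h).op).hom

lemma resSpec_eq_comap {R : Type u} [CommRing R] {U V : Opens (PrimeSpectrum.Top R)}
    (h : V ≤ U) : resSpec h = StructureSheaf.comap (RingHom.id R) U V fun _ hq => h hq :=
  (StructureSheaf.comap_id_eq_map U V (homOfLE h)).symm

/-- Compatibility of `StructureSheaf.comap` with restrictions. -/
lemma comap_resSpec {R S : Type u} [CommRing R] [CommRing S] (f : R →+* S)
    {U U' : Opens (PrimeSpectrum.Top R)} {V V' : Opens (PrimeSpectrum.Top S)}
    (hU : U' ≤ U) (hV : V' ≤ V)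
    (h : V.1 ⊆ PrimeSpectrum.comap f ⁻¹' U.1) (h' : V'.1 ⊆ PrimeSpectrum.comap f ⁻¹' U'.1)
    (s : (Spec.structureSheaf R).1.obj (op U)) :
    StructureSheaf.comap f U' V' h' (resSpec hU s) =
      resSpec hV (StructureSheaf.comap f U V h s) := by
  rw [resSpec_eq_comap, resSpec_eq_comap]
  exact (comap_comp_apply _ _ f rfl _ _ (fun _ hq => hU (h' hq)) s).trans
    (comap_comp_apply _ _ f rfl _ _ (fun _ hq => h (hV hq)) s).symm

/-- Restriction of sections. -/
noncomputable def res {U V : Opens (space A)} (h : V ≤ U) : Sections U →+* Sections V :=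
  RingHom.codRestrict
    (RingHom.pi fun I => (resSpec (pre_mono I h)).comp (component I)) (sectionsSubring V)
    (fun s I J hIJ => by
      have := transition_component hIJ s
      simp only [RingHom.pi_apply, RingHom.comp_apply]
      rw [← this]
      exact comap_resSpec _ _ _ _ _ _)

lemma component_res {U V : Opens (space A)} (h : V ≤ U) (I : OpenIdeal A) (s : Sections U) :
    component I (res h s) = resSpec (pre_mono I h) (component I s) := rfl

lemma continuous_res {U V : Opens (space A)} (h : V ≤ U) : Continuous (res h) := by
  refine continuous_of_component fun I => ?_
  let : TopologicalSpace ((Spec.structureSheaf (A ⧸ I.1)).1.obj (op (pre I U))) := ⊥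
  have : DiscreteTopology ((Spec.structureSheaf (A ⧸ I.1)).1.obj (op (pre I U))) := ⟨rfl⟩
  let : TopologicalSpace ((Spec.structureSheaf (A ⧸ I.1)).1.obj (op (pre I V))) := ⊥
  exact (continuous_of_discreteTopology (f := resSpec (pre_mono I h))).comp
    (continuous_component I)

variable (A) in
/-- The structure sheaf of `Spf A`, as a presheaf of topological rings. -/
noncomputable def presheaf : (space A).Presheaf TopCommRingCat.{u} where
  obj U := TopCommRingCat.of (Sections U.unop)
  map i := ⟨res (leOfHom i.unop), continuous_res _⟩
  map_id U := by
    refine Subtype.ext (RingHom.ext fun s => Sections.ext fun I => ?_)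
    exact congrArg (fun f => f (component I s))
      (congrArg CommRingCat.Hom.hom ((Spec.structureSheaf (A ⧸ I.1)).1.map_id _))
  map_comp i j := by
    refine Subtype.ext (RingHom.ext fun s => Sections.ext fun I => ?_)
    exact congrArg (fun f => f (component I s))
      (congrArg CommRingCat.Hom.hom ((Spec.structureSheaf (A ⧸ I.1)).1.map_comp
        (homOfLE (pre_mono I (leOfHom i.unop))).op (homOfLE (pre_mono I (leOfHom j.unop))).op))

end Space
end Spf

namespace Spf

open AlgebraicGeometry

section Sheaf

variable (A : Type u) [CommRing A] [UniformSpace A] [CompleteTopRing A]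

/-- The structure presheaf of `Spf A` is a sheaf of rings. -/
lemma presheaf_isSheaf :
    TopCat.Presheaf.IsSheaf (presheaf A ⋙ forget₂ TopCommRingCat.{u} CommRingCat.{u}) := by
  rw [TopCat.Presheaf.isSheaf_iff_isSheafUniqueGluing]
  intro ι U sf hsf
  have hsf' : ∀ i j, res inf_le_left (sf i : Sections (U i)) =
    res inf_le_right (sf j : Sections (U j)) := hsf
  have hcov : ∀ I : OpenIdeal A, pre I (iSup U) ≤ ⨆ i, pre I (U i) := by
    intro I q hq
    obtain ⟨i, hi⟩ := Opens.mem_iSup.1 (mem_pre.1 hq)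
    exact Opens.mem_iSup.2 ⟨i, hi⟩
  have key := fun I : OpenIdeal A => (Spec.structureSheaf (A ⧸ I.1)).existsUnique_gluing'
    (fun i => pre I (U i)) (pre I (iSup U)) (fun i => homOfLE (pre_mono I (le_iSup U i)))
    (hcov I) (fun i => component I (sf i : Sections (U i)))
    (fun i j => congrArg (component I) (hsf' i j))
  choose gl hgl huniq using key
  have hgl' : ∀ I i, resSpec (pre_mono I (le_iSup U i)) (gl I) =
    component I (sf i : Sections (U i)) := hgl
  refine ⟨(⟨gl, fun I J h => ?_⟩ : Sections (iSup U)), fun i => Sections.ext fun I => hgl I i,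
    fun t ht => Sections.ext fun I => ?_⟩
  · refine huniq J _ fun i => ?_
    refine Eq.trans ?_ (transition_component h (sf i : Sections (U i)))
    rw [← hgl' I i]
    exact (comap_resSpec _ _ _ _ _ _).symm
  · exact huniq I _ fun i => congrArg (component I) (ht i)

end Sheaf

end Spf

open AlgebraicGeometry in
/-- The affine ind-scheme `Spf A` of a complete topological ring `A`. -/
noncomputable def Spf (A : Type u) [CommRing A] [UniformSpace A] [CompleteTopRing A] :
    TopRingedSpace.{u} where
  carrier := Spf.space A
  presheaf := Spf.presheaf A
  isSheaf := Spf.presheaf_isSheaf A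

namespace Spf

open AlgebraicGeometry

section Map

variable {A B C : Type u} [CommRing A] [UniformSpace A] [CompleteTopRing A]
  [CommRing B] [UniformSpace B] [CompleteTopRing B]
  [CommRing C] [UniformSpace C] [CompleteTopRing C]

/-- The inverse image of an open ideal under a continuous ring homomorphism. -/
def comapIdeal (φ : A →+* B) (hφ : Continuous φ) (J : OpenIdeal B) : OpenIdeal A :=
  ⟨J.1.comap φ, J.2.preimage hφ⟩

/-- The map `Spf B → Spf A`. -/
def mapSpace (φ : A →+* B) (hφ : Continuous φ) : space B ⟶ space A :=
  TopCat.ofHom ⟨fun q => ⟨PrimeSpectrum.comap φ q.1, q.2.preimage hφ⟩,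
    ((PrimeSpectrum.continuous_comap φ).comp continuous_subtype_val).subtype_mk _⟩

/-- The homomorphism `A ⧸ φ⁻¹ J → B ⧸ J`. -/
def quotMap (φ : A →+* B) (hφ : Continuous φ) (J : OpenIdeal B) :
    A ⧸ (comapIdeal φ hφ J).1 →+* B ⧸ J.1 :=
  Ideal.quotientMap J.1 φ le_rfl

lemma incl_comap_quotMap (φ : A →+* B) (hφ : Continuous φ) (J : OpenIdeal B)
    (q : PrimeSpectrum (B ⧸ J.1)) :
    incl (comapIdeal φ hφ J) (PrimeSpectrum.comap (quotMap φ hφ J) q) =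
      mapSpace φ hφ (incl J q) :=
  Subtype.ext (PrimeSpectrum.ext (Ideal.ext fun _ => Iff.rfl))

/-- The map on sections over an open subset of `Spec (A ⧸ φ⁻¹ J)` induced by
`A ⧸ φ⁻¹ J → B ⧸ J`. -/
noncomputable def mapComponent (φ : A →+* B) (hφ : Continuous φ) (U : Opens (space A))
    (J : OpenIdeal B) :
    (Spec.structureSheaf (A ⧸ (comapIdeal φ hφ J).1)).1.obj
        (op (pre (comapIdeal φ hφ J) U)) →+*
      (Spec.structureSheaf (B ⧸ J.1)).1.obj
        (op (pre J ((Opens.map (mapSpace φ hφ)).obj U))) :=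
  StructureSheaf.comap (quotMap φ hφ J) _ _ fun q hq =>
    (congrArg (fun p => p ∈ U) (incl_comap_quotMap φ hφ J q)).mpr hq

/-- The map `𝒪_{Spf A}(U) → 𝒪_{Spf B}(f⁻¹ U)`. -/
noncomputable def mapSections (φ : A →+* B) (hφ : Continuous φ) (U : Opens (space A)) :
    Sections U →+* Sections ((Opens.map (mapSpace φ hφ)).obj U) :=
  RingHom.codRestrict
    (RingHom.pi fun J => (mapComponent φ hφ U J).comp (component (comapIdeal φ hφ J)))
    (sectionsSubring _) (fun s I J hIJ => by
      have hIJ' : (comapIdeal φ hφ I).1 ≤ (comapIdeal φ hφ J).1 := Ideal.comap_mono hIJ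
      have := transition_component hIJ' s
      simp only [RingHom.pi_apply, RingHom.comp_apply]
      rw [← this]
      have e : (Ideal.Quotient.factor hIJ).comp (quotMap φ hφ I) =
          (quotMap φ hφ J).comp (Ideal.Quotient.factor hIJ') :=
        Ideal.Quotient.ringHom_ext rfl
      have hq : (pre J ((Opens.map (mapSpace φ hφ)).obj U)).1 ⊆
          PrimeSpectrum.comap ((quotMap φ hφ J).comp (Ideal.Quotient.factor hIJ')) ⁻¹'
            (pre (comapIdeal φ hφ I) U).1 := fun q hq => by
        have h : incl (comapIdeal φ hφ I) (PrimeSpectrum.comap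
            ((quotMap φ hφ J).comp (Ideal.Quotient.factor hIJ')) q) = mapSpace φ hφ (incl J q) :=
          Subtype.ext (PrimeSpectrum.ext (Ideal.ext fun _ => Iff.rfl))
        exact (congrArg (fun p => p ∈ U) h).mpr hq
      exact (comap_comp_apply _ _ _ e _ _ hq _).trans
        (comap_comp_apply _ _ _ rfl _ _ hq _).symm)

lemma component_mapSections (φ : A →+* B) (hφ : Continuous φ) (U : Opens (space A))
    (J : OpenIdeal B) (s : Sections U) :
    component J (mapSections φ hφ U s) =
      mapComponent φ hφ U J (component (comapIdeal φ hφ J) s) := rfl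

lemma continuous_mapSections (φ : A →+* B) (hφ : Continuous φ) (U : Opens (space A)) :
    Continuous (mapSections φ hφ U) := by
  refine continuous_of_component fun J => ?_
  let : TopologicalSpace ((Spec.structureSheaf (A ⧸ (comapIdeal φ hφ J).1)).1.obj
    (op (pre (comapIdeal φ hφ J) U))) := ⊥
  have : DiscreteTopology ((Spec.structureSheaf (A ⧸ (comapIdeal φ hφ J).1)).1.obj
    (op (pre (comapIdeal φ hφ J) U))) := ⟨rfl⟩
  let : TopologicalSpace ((Spec.structureSheaf (B ⧸ J.1)).1.obj
        (op (pre J ((Opens.map (mapSpace φ hφ)).obj U)))) := ⊥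
  exact (continuous_of_discreteTopology (f := mapComponent φ hφ U J)).comp
    (continuous_component _)

/-- The morphism `Spf B ⟶ Spf A` associated to a continuous ring homomorphism `A → B`. -/
noncomputable def map (φ : A →+* B) (hφ : Continuous φ) : Spf B ⟶ Spf A where
  hom :=
  { base := mapSpace φ hφ
    c :=
    { app U := ⟨mapSections φ hφ U.unop, continuous_mapSections φ hφ U.unop⟩
      naturality U V i := by
        refine Subtype.ext (RingHom.ext fun s => Sections.ext fun J => ?_)
        exact comap_resSpec _ _ _ _ _ _ } }

lemma mapSections_comp (φ : A →+* B) (hφ : Continuous φ) (ψ : B →+* C) (hψ : Continuous ψ)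
    (U : Opens (space A)) (s : Sections U) :
    mapSections (ψ.comp φ) (hψ.comp hφ) U s = mapSections ψ hψ _ (mapSections φ hφ U s) := by
  refine Sections.ext fun J => ?_
  have e : (quotMap ψ hψ J).comp (quotMap φ hφ (comapIdeal ψ hψ J)) =
    quotMap (ψ.comp φ) (hψ.comp hφ) J := Ideal.Quotient.ringHom_ext rfl
  exact (comap_comp_apply _ _ _ e _ _ _ _).symm

lemma mapSpace_comp (φ : A →+* B) (hφ : Continuous φ) (ψ : B →+* C) (hψ : Continuous ψ) :
    mapSpace (ψ.comp φ) (hψ.comp hφ) = mapSpace ψ hψ ≫ mapSpace φ hφ := rfl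

lemma map_comp (φ : A →+* B) (hφ : Continuous φ) (ψ : B →+* C) (hψ : Continuous ψ) :
    map (ψ.comp φ) (hψ.comp hφ) = map ψ hψ ≫ map φ hφ := by
  refine InducedCategory.hom_ext ?_
  refine PresheafedSpace.hext _ _ (mapSpace_comp φ hφ ψ hψ) ?_
  have h : (map (ψ.comp φ) (hψ.comp hφ)).hom.c = (map φ hφ).hom.c ≫
      (TopCat.Presheaf.pushforward _ (mapSpace φ hφ)).map (map ψ hψ).hom.c := by
    refine NatTrans.ext (funext fun U => Subtype.ext (RingHom.ext fun s => ?_))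
    exact mapSections_comp φ hφ ψ hψ U.unop s
  exact heq_of_eq h

lemma mapSpace_id : mapSpace (RingHom.id A) continuous_id = 𝟙 (space A) := rfl

lemma mapSections_id (U : Opens (space A)) (s : Sections U) :
    mapSections (RingHom.id A) continuous_id U s = s := by
  refine Sections.ext fun J => ?_
  have e : (quotMap (RingHom.id A) continuous_id J) = RingHom.id (A ⧸ J.1) :=
    Ideal.Quotient.ringHom_ext rfl
  have h : ∀ (f : A ⧸ J.1 →+* A ⧸ J.1) (_ : f = RingHom.id (A ⧸ J.1))
    (h : (pre J U).1 ⊆ PrimeSpectrum.comap f ⁻¹' (pre J U).1),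
      StructureSheaf.comap f _ _ h (component J s) = component J s := by
    rintro f rfl h
    exact DFunLike.congr_fun (StructureSheaf.comap_id' (pre J U)) (component J s)
  exact h _ e _

lemma map_id : map (RingHom.id A) continuous_id = 𝟙 (Spf A) := by
  refine InducedCategory.hom_ext ?_
  refine PresheafedSpace.hext _ _ mapSpace_id ?_
  have h : (map (RingHom.id A) continuous_id).hom.c = 𝟙 (presheaf A) := by
    refine NatTrans.ext (funext fun U => Subtype.ext (RingHom.ext fun s => ?_))
    exact mapSections_id U.unop s
  exact heq_of_eq h

end Map

end Spf

namespace Spf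

open AlgebraicGeometry

section GlobalSections

variable {A B : Type u} [CommRing A] [UniformSpace A] [CompleteTopRing A]
  [CommRing B] [UniformSpace B] [CompleteTopRing B]

variable (A) in
/-- The global sections of the structure sheaf of `Spf A`. -/
abbrev GlobalSections : Type u := Sections (⊤ : Opens (space A))

/-- The map on global sections induced by a morphism `Spf B ⟶ Spf A`. -/
noncomputable def globalMap (f : Spf B ⟶ Spf A) : GlobalSections A →+* GlobalSections B :=
  (f.hom.c.app (op ⊤)).1

/-- An element of `R` as a section of the structure sheaf of `Spec R`. -/
noncomputable def toSpec {R : Type u} [CommRing R] (U : Opens (PrimeSpectrum.Top R)) :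
    R →+* (Spec.structureSheaf R).1.obj (op U) :=
  @algebraMap R ((Spec.structureSheaf R).1.obj (op U)) _ _ (StructureSheaf.openAlgebra R (op U))

lemma comap_toSpec {R S : Type u} [CommRing R] [CommRing S] (f : R →+* S)
    (U : Opens (PrimeSpectrum.Top R)) (V : Opens (PrimeSpectrum.Top S))
    (h : V.1 ⊆ PrimeSpectrum.comap f ⁻¹' U.1) (r : R) :
    StructureSheaf.comap f U V h (toSpec U r) = toSpec V (f r) := by
  refine Subtype.ext (funext fun p => ?_)
  refine (StructureSheaf.comap_apply f U V h _ p).trans ?_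
  have key : ∀ q : PrimeSpectrum S, Localization.localRingHom (PrimeSpectrum.comap f q).asIdeal
      q.asIdeal f rfl (algebraMap R _ r) = algebraMap S _ (f r) := fun q =>
    Localization.localRingHom_to_map _ _ _ _ _
  exact key p.1

lemma toSpec_top_injective {R : Type u} [CommRing R] :
    Function.Injective (toSpec (⊤ : Opens (PrimeSpectrum.Top R))) :=
  StructureSheaf.algebraMap_obj_top_bijective.1

/-- An element of `A` as a global section of the structure sheaf of `Spf A`. -/
noncomputable def toGlobal : A →+* GlobalSections A :=
  RingHom.codRestrict
    (RingHom.pi fun I => (toSpec (pre I ⊤)).comp (Ideal.Quotient.mk I.1))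
    (sectionsSubring _) (fun a I _ h =>
      (comap_toSpec (Ideal.Quotient.factor h) _ _ _ (Ideal.Quotient.mk I.1 a)))

lemma component_toGlobal (I : OpenIdeal A) (a : A) :
    component I (toGlobal a) = toSpec (pre I ⊤) (Ideal.Quotient.mk I.1 a) := rfl

lemma toGlobal_injective : Function.Injective (toGlobal (A := A)) := by
  intro a b h
  rw [← sub_eq_zero]
  refine OpenIdeal.eq_zero_of_forall_mem fun I => ?_
  have h1 := congrArg (component I) h
  rw [component_toGlobal, component_toGlobal] at h1
  have h2 : Ideal.Quotient.mk I.1 a = Ideal.Quotient.mk I.1 b := toSpec_top_injective h1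
  rwa [Ideal.Quotient.mk_eq_mk_iff_sub_mem] at h2

lemma globalMap_map_toGlobal (φ : A →+* B) (hφ : Continuous φ) (a : A) :
    globalMap (map φ hφ) (toGlobal a) = toGlobal (φ a) :=
  Sections.ext fun J => comap_toSpec (quotMap φ hφ J) _ _ _ (Ideal.Quotient.mk _ a)

/-- A continuous homomorphism is determined by the morphism it induces. -/
lemma map_injective {φ ψ : A →+* B} (hφ : Continuous φ) (hψ : Continuous ψ)
    (h : map φ hφ = map ψ hψ) : φ = ψ := by
  refine RingHom.ext fun a => toGlobal_injective ?_
  rw [← globalMap_map_toGlobal φ hφ, ← globalMap_map_toGlobal ψ hψ, h]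

end GlobalSections

end Spf

/-- An affine ind-scheme, presented as `Spf` of a complete topological ring. -/
structure AffIndScheme : Type (u + 1) where
  ring : Type u
  [commRing : CommRing ring]
  [uniformSpace : UniformSpace ring]
  [completeTopRing : CompleteTopRing ring]

namespace AffIndScheme

attribute [instance] commRing uniformSpace completeTopRing

/-- The underlying topologically ringed space of an affine ind-scheme. -/
noncomputable def space (X : AffIndScheme.{u}) : TopRingedSpace.{u} := Spf X.ring

/-- Morphisms of affine ind-schemes are the morphisms of topologically ringed spaces that are
induced by a continuous ring homomorphism. -/
noncomputable instance : Category AffIndScheme.{u} where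
  Hom X Y := {f : X.space ⟶ Y.space //
    ∃ (φ : Y.ring →+* X.ring) (hφ : Continuous φ), f = Spf.map φ hφ}
  id X := ⟨𝟙 X.space, RingHom.id _, continuous_id, Spf.map_id.symm⟩
  comp {X Y Z} f g := ⟨f.1 ≫ g.1, by
    obtain ⟨φ, hφ, h1⟩ := f.2
    obtain ⟨ψ, hψ, h2⟩ := g.2
    refine ⟨φ.comp ψ, hφ.comp hψ, ?_⟩
    rw [h1, h2]
    exact (Spf.map_comp ψ hψ φ hφ).symm⟩
  id_comp f := Subtype.ext (Category.id_comp f.1)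
  comp_id f := Subtype.ext (Category.comp_id f.1)
  assoc f g h := Subtype.ext (Category.assoc f.1 g.1 h.1)

variable {X Y Z : AffIndScheme.{u}}

/-- The morphism induced by a continuous ring homomorphism. -/
noncomputable def ofRingHom (φ : Y.ring →+* X.ring) (hφ : Continuous φ) : X ⟶ Y :=
  ⟨Spf.map φ hφ, φ, hφ, rfl⟩

/-- The comorphism of `f : X ⟶ Y`: the (unique) continuous homomorphism of complete topological
rings inducing `f`; equivalently the map induced by `f` on global sections. -/
noncomputable def comorphism (f : X ⟶ Y) : Y.ring →+* X.ring := f.2.choose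

lemma continuous_comorphism (f : X ⟶ Y) : Continuous (comorphism f) := f.2.choose_spec.choose

lemma ofRingHom_comorphism (f : X ⟶ Y) :
    ofRingHom (comorphism f) (continuous_comorphism f) = f :=
  Subtype.ext f.2.choose_spec.choose_spec.symm

lemma globalMap_toGlobal (f : X ⟶ Y) (b : Y.ring) :
    Spf.globalMap f.1 (Spf.toGlobal b) = Spf.toGlobal (comorphism f b) :=
  (congrArg (fun g : X ⟶ Y => Spf.globalMap g.1 (Spf.toGlobal b))
    (ofRingHom_comorphism f).symm).trans
      (Spf.globalMap_map_toGlobal _ (continuous_comorphism f) b)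

@[simp] lemma comorphism_ofRingHom (φ : Y.ring →+* X.ring) (hφ : Continuous φ) :
    comorphism (ofRingHom φ hφ) = φ :=
  Spf.map_injective (continuous_comorphism _) hφ
    (congrArg Subtype.val (ofRingHom_comorphism (ofRingHom φ hφ)))

lemma hom_ext {f g : X ⟶ Y} (h : comorphism f = comorphism g) : f = g := by
  rw [← ofRingHom_comorphism f, ← ofRingHom_comorphism g]
  congr 1

@[simp] lemma comorphism_id : comorphism (𝟙 X) = RingHom.id X.ring :=
  Spf.map_injective (continuous_comorphism _) continuous_id
    ((congrArg Subtype.val (ofRingHom_comorphism (𝟙 X))).trans Spf.map_id.symm)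

@[simp] lemma comorphism_comp (f : X ⟶ Y) (g : Y ⟶ Z) :
    comorphism (f ≫ g) = (comorphism f).comp (comorphism g) := by
  refine Spf.map_injective (continuous_comorphism _)
    ((continuous_comorphism f).comp (continuous_comorphism g))
    ((congrArg Subtype.val (ofRingHom_comorphism (f ≫ g))).trans ?_)
  refine Eq.trans ?_ (Spf.map_comp (comorphism g) (continuous_comorphism g) (comorphism f)
    (continuous_comorphism f)).symm
  exact congrArg₂ (fun a b => a ≫ b) (congrArg Subtype.val (ofRingHom_comorphism f)).symm
    (congrArg Subtype.val (ofRingHom_comorphism g)).symm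

end AffIndScheme

section CompletedTensor

open TensorProduct

/-- The linear topology on `B ⊗[A] B'` generated by the ideals `J ⊗ B' + B ⊗ J'` with `J` and `J'`
open ideals of `B` and `B'`. -/
def tensorSystem (A B B' : Type u) [CommRing A] [CommRing B] [UniformSpace B] [CompleteTopRing B]
    [CommRing B'] [UniformSpace B'] [CompleteTopRing B'] [Algebra A B] [Algebra A B'] :
    IdealSystem (B ⊗[A] B') where
  ι := OpenIdeal B × OpenIdeal B'
  ideal K := K.1.1.map (Algebra.TensorProduct.includeLeft (R := A) (S := A) (A := B) (B := B')) ⊔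
    K.2.1.map (Algebra.TensorProduct.includeRight (R := A) (A := B) (B := B'))
  exists_seq := by
    obtain ⟨s, hs⟩ := OpenIdeal.exists_seq (A := B)
    obtain ⟨t, ht⟩ := OpenIdeal.exists_seq (A := B')
    refine ⟨fun n => (s n, t n), fun K => ?_⟩
    obtain ⟨N, hN⟩ := hs K.1
    obtain ⟨M, hM⟩ := ht K.2
    exact ⟨max N M, fun n hn => sup_le_sup (Ideal.map_mono (hN n (le_of_max_le_left hn)))
      (Ideal.map_mono (hM n (le_of_max_le_right hn)))⟩

/-- The completed tensor product of topological `A`-algebras. -/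
abbrev CompletedTensor (A B B' : Type u) [CommRing A] [CommRing B] [UniformSpace B]
    [CompleteTopRing B] [CommRing B'] [UniformSpace B'] [CompleteTopRing B'] [Algebra A B]
    [Algebra A B'] : Type u := (tensorSystem A B B').Compl

namespace CompletedTensor

variable {A B B' C : Type u} [CommRing A] [CommRing B] [UniformSpace B] [CompleteTopRing B]
  [CommRing B'] [UniformSpace B'] [CompleteTopRing B'] [Algebra A B] [Algebra A B']
  [CommRing C] [UniformSpace C] [CompleteTopRing C]

variable (A B B') in
/-- The map `b ↦ b ⊗ 1`. -/
noncomputable def inl : B →+* CompletedTensor A B B' :=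
  (tensorSystem A B B').of.comp
    (Algebra.TensorProduct.includeLeft (R := A) (S := A) (A := B) (B := B')).toRingHom

variable (A B B') in
/-- The map `b' ↦ 1 ⊗ b'`. -/
noncomputable def inr : B' →+* CompletedTensor A B B' :=
  (tensorSystem A B B').of.comp
    (Algebra.TensorProduct.includeRight (R := A) (A := B) (B := B')).toRingHom

lemma inl_comp_algebraMap :
    (inl A B B').comp (algebraMap A B) = (inr A B B').comp (algebraMap A B') := by
  ext1 a
  exact congrArg (tensorSystem A B B').of
    ((Algebra.TensorProduct.includeLeft (R := A) (S := A) (A := B) (B := B')).commutes a |>.trans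
    ((Algebra.TensorProduct.includeRight (R := A) (A := B) (B := B')).commutes a).symm)

end CompletedTensor
end CompletedTensor

section

variable {A B B' C : Type u} [CommRing A] [CommRing B] [UniformSpace B] [CompleteTopRing B]
  [CommRing B'] [UniformSpace B'] [CompleteTopRing B'] [Algebra A B] [Algebra A B']
  [CommRing C] [UniformSpace C] [CompleteTopRing C]

namespace IdealSystem

/-- A homomorphism to a separated completion is continuous if the inverse images of the defining
ideals are open. -/
lemma continuous_of_isOpen {R : Type u} [CommRing R] (F : IdealSystem R) (f : C →+* F.Compl)
    (h : ∀ i, ∃ I : OpenIdeal C, ∀ c ∈ I.1, F.proj i (f c) = 0) : Continuous f := by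
  refine continuous_of_continuousAt_zero f.toAddMonoidHom ?_
  change Filter.Tendsto f (𝓝 0) (𝓝 (f 0))
  rw [map_zero, F.nhds_zero_hasBasis.tendsto_right_iff]
  intro i _
  obtain ⟨I, hI⟩ := h i
  filter_upwards [I.2.mem_nhds (zero_mem I.1)] with c hc using hI c hc

end IdealSystem

namespace CompletedTensor

open TensorProduct

variable (A B B') in
lemma continuous_inl : Continuous (inl A B B') :=
  IdealSystem.continuous_of_isOpen _ _ fun K => ⟨K.1, fun _ hb =>
    Ideal.Quotient.eq_zero_iff_mem.2 (Ideal.mem_sup_left (Ideal.mem_map_of_mem _ hb))⟩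

variable (A B B') in
lemma continuous_inr : Continuous (inr A B B') :=
  IdealSystem.continuous_of_isOpen _ _ fun K => ⟨K.2, fun _ hb =>
    Ideal.Quotient.eq_zero_iff_mem.2 (Ideal.mem_sup_right (Ideal.mem_map_of_mem _ hb))⟩

/-- The completed tensor product is the pushout of complete topological rings. -/
lemma exists_desc (f : B →+* C) (g : B' →+* C) (hf : Continuous f) (hg : Continuous g)
    (h : f.comp (algebraMap A B) = g.comp (algebraMap A B')) :
    ∃ k : CompletedTensor A B B' →+* C, Continuous k ∧ k.comp (inl A B B') = f ∧
      k.comp (inr A B B') = g := by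
  let : Algebra A C := (f.comp (algebraMap A B)).toAlgebra
  let f' : B →ₐ[A] C := { f with commutes' := fun _ => rfl }
  let g' : B' →ₐ[A] C := { g with commutes' := fun a => (DFunLike.congr_fun h a).symm }
  let p := Algebra.TensorProduct.productMap f' g'
  have hp : (tensorSystem A B B').IsCont p.toRingHom := by
    intro K hK
    refine ⟨(⟨K.comap f, hK.preimage hf⟩, ⟨K.comap g, hK.preimage hg⟩), sup_le ?_ ?_⟩
    · refine Ideal.map_le_iff_le_comap.2 fun b hb => ?_
      change p (b ⊗ₜ 1) ∈ K
      rw [Algebra.TensorProduct.productMap_apply_tmul, map_one, mul_one]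
      exact hb
    · refine Ideal.map_le_iff_le_comap.2 fun b hb => ?_
      change p (1 ⊗ₜ b) ∈ K
      rw [Algebra.TensorProduct.productMap_apply_tmul, map_one, one_mul]
      exact hb
  refine ⟨IdealSystem.lift p.toRingHom hp, IdealSystem.continuous_lift _ _, ?_, ?_⟩
  · refine RingHom.ext fun b => (IdealSystem.lift_of _ hp _).trans ?_
    change p (b ⊗ₜ 1) = f b
    rw [Algebra.TensorProduct.productMap_apply_tmul, map_one, mul_one]
    rfl
  · refine RingHom.ext fun b => (IdealSystem.lift_of _ hp _).trans ?_
    change p (1 ⊗ₜ b) = g b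
    rw [Algebra.TensorProduct.productMap_apply_tmul, map_one, one_mul]
    rfl

lemma hom_ext {k₁ k₂ : CompletedTensor A B B' →+* C} (h₁ : Continuous k₁) (h₂ : Continuous k₂)
    (hl : k₁.comp (inl A B B') = k₂.comp (inl A B B'))
    (hr : k₁.comp (inr A B B') = k₂.comp (inr A B B')) : k₁ = k₂ := by
  refine IdealSystem.hom_ext h₁ h₂ (RingHom.ext fun x => ?_)
  induction x using TensorProduct.induction_on with
  | zero => simp
  | add x y hx hy => rw [map_add, map_add, hx, hy]
  | tmul b b' =>
    have e : b ⊗ₜ[A] b' = (b ⊗ₜ 1) * (1 ⊗ₜ b') := by simp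
    rw [e, map_mul, map_mul]
    exact congrArg₂ (· * ·) (DFunLike.congr_fun hl b) (DFunLike.congr_fun hr b')

end CompletedTensor

end

namespace AffIndScheme

open Limits

section FibreProduct

variable {S X Y : AffIndScheme.{u}} (f : X ⟶ S) (g : Y ⟶ S)

/-- The fibre product `X ×_S Y`, namely `Spf` of the completed tensor product. -/
noncomputable def fibreProduct : AffIndScheme.{u} :=
  letI := (comorphism f).toAlgebra
  letI := (comorphism g).toAlgebra
  ⟨CompletedTensor S.ring X.ring Y.ring⟩

/-- The map `b ↦ b ⊗ 1`. -/
noncomputable def fibreInl : X.ring →+* (fibreProduct f g).ring :=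
  letI := (comorphism f).toAlgebra
  letI := (comorphism g).toAlgebra
  CompletedTensor.inl S.ring X.ring Y.ring

/-- The map `b' ↦ 1 ⊗ b'`. -/
noncomputable def fibreInr : Y.ring →+* (fibreProduct f g).ring :=
  letI := (comorphism f).toAlgebra
  letI := (comorphism g).toAlgebra
  CompletedTensor.inr S.ring X.ring Y.ring

lemma continuous_fibreInl : Continuous (fibreInl f g) :=
  letI := (comorphism f).toAlgebra
  letI := (comorphism g).toAlgebra
  CompletedTensor.continuous_inl S.ring X.ring Y.ring

lemma continuous_fibreInr : Continuous (fibreInr f g) :=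
  letI := (comorphism f).toAlgebra
  letI := (comorphism g).toAlgebra
  CompletedTensor.continuous_inr S.ring X.ring Y.ring

lemma fibre_comp : (fibreInl f g).comp (comorphism f) = (fibreInr f g).comp (comorphism g) :=
  letI := (comorphism f).toAlgebra
  letI := (comorphism g).toAlgebra
  CompletedTensor.inl_comp_algebraMap (A := S.ring) (B := X.ring) (B' := Y.ring)

lemma exists_fibreDesc {C : Type u} [CommRing C] [UniformSpace C] [CompleteTopRing C]
    (a : X.ring →+* C) (b : Y.ring →+* C) (ha : Continuous a) (hb : Continuous b)
    (h : a.comp (comorphism f) = b.comp (comorphism g)) :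
    ∃ k : (fibreProduct f g).ring →+* C, Continuous k ∧ k.comp (fibreInl f g) = a ∧
      k.comp (fibreInr f g) = b :=
  letI := (comorphism f).toAlgebra
  letI := (comorphism g).toAlgebra
  CompletedTensor.exists_desc (A := S.ring) a b ha hb h

lemma fibre_ringHom_ext {C : Type u} [CommRing C] [UniformSpace C] [CompleteTopRing C]
    {k l : (fibreProduct f g).ring →+* C} (hk : Continuous k) (hl : Continuous l)
    (h₁ : k.comp (fibreInl f g) = l.comp (fibreInl f g))
    (h₂ : k.comp (fibreInr f g) = l.comp (fibreInr f g)) : k = l :=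
  letI := (comorphism f).toAlgebra
  letI := (comorphism g).toAlgebra
  CompletedTensor.hom_ext (A := S.ring) (B := X.ring) (B' := Y.ring) hk hl h₁ h₂

/-- The first projection of the fibre product. -/
noncomputable def fibreFst : fibreProduct f g ⟶ X :=
  ofRingHom (fibreInl f g) (continuous_fibreInl f g)

/-- The second projection of the fibre product. -/
noncomputable def fibreSnd : fibreProduct f g ⟶ Y :=
  ofRingHom (fibreInr f g) (continuous_fibreInr f g)

lemma fibre_condition : fibreFst f g ≫ f = fibreSnd f g ≫ g := by
  refine hom_ext ?_
  rw [comorphism_comp, comorphism_comp, fibreFst, fibreSnd, comorphism_ofRingHom,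
    comorphism_ofRingHom, fibre_comp]

lemma exists_fibreLift {T : AffIndScheme.{u}} (a : T ⟶ X) (b : T ⟶ Y) (h : a ≫ f = b ≫ g) :
    ∃ l : T ⟶ fibreProduct f g, l ≫ fibreFst f g = a ∧ l ≫ fibreSnd f g = b := by
  have h' := congrArg comorphism h
  rw [comorphism_comp, comorphism_comp] at h'
  obtain ⟨k, hk, hl, hr⟩ := exists_fibreDesc f g (comorphism a)
    (comorphism b) (continuous_comorphism a) (continuous_comorphism b) h'
  refine ⟨ofRingHom k hk, hom_ext ?_, hom_ext ?_⟩
  · rw [comorphism_comp, comorphism_ofRingHom, fibreFst, comorphism_ofRingHom, hl]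
  · rw [comorphism_comp, comorphism_ofRingHom, fibreSnd, comorphism_ofRingHom, hr]

lemma fibre_hom_ext {T : AffIndScheme.{u}} {k l : T ⟶ fibreProduct f g}
    (h₁ : k ≫ fibreFst f g = l ≫ fibreFst f g) (h₂ : k ≫ fibreSnd f g = l ≫ fibreSnd f g) :
    k = l := by
  have h₁' := congrArg comorphism h₁
  have h₂' := congrArg comorphism h₂
  rw [comorphism_comp, comorphism_comp, fibreFst, comorphism_ofRingHom] at h₁'
  rw [comorphism_comp, comorphism_comp, fibreSnd, comorphism_ofRingHom] at h₂'
  exact hom_ext (fibre_ringHom_ext f g (continuous_comorphism k) (continuous_comorphism l)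
    h₁' h₂')

/-- The fibre product as a pullback cone. -/
noncomputable def fibreCone : PullbackCone f g :=
  PullbackCone.mk (fibreFst f g) (fibreSnd f g) (fibre_condition f g)

/-- The fibre product is a pullback in the category of affine ind-schemes. -/
noncomputable def fibreConeIsLimit : IsLimit (fibreCone f g) :=
  PullbackCone.IsLimit.mk _ (fun s => (exists_fibreLift f g s.fst s.snd s.condition).choose)
    (fun s => (exists_fibreLift f g s.fst s.snd s.condition).choose_spec.1)
    (fun s => (exists_fibreLift f g s.fst s.snd s.condition).choose_spec.2)
    (fun s _ h₁ h₂ => fibre_hom_ext f g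
      (h₁.trans (exists_fibreLift f g s.fst s.snd s.condition).choose_spec.1.symm)
      (h₂.trans (exists_fibreLift f g s.fst s.snd s.condition).choose_spec.2.symm))

end FibreProduct

/-- The cartesian monoidal structure on affine ind-schemes over `S` given by the fibre product. -/
noncomputable instance (S : AffIndScheme.{u}) : CartesianMonoidalCategory (Over S) :=
  .ofChosenFiniteProducts
    ⟨asEmptyCone (Over.mk (𝟙 S)), IsTerminal.ofUniqueHom (fun Y => Over.homMk Y.hom)
      fun Y m => Over.OverMorphism.ext (by simpa using m.w)⟩
    fun Y Z => ⟨pullbackConeEquivBinaryFan.functor.obj (fibreCone Y.hom Z.hom),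
      (fibreConeIsLimit Y.hom Z.hom).pullbackConeEquivBinaryFanFunctor⟩

end AffIndScheme

section RestrictedPowerSeries

variable (A : Type u) [CommRing A] [UniformSpace A] [CompleteTopRing A]

/-- The linear topology on the polynomial ring `A[T]` generated by the ideals `I[T]`, with `I` an
open ideal of `A`. -/
noncomputable def polySystem : IdealSystem (Polynomial A) where
  ι := OpenIdeal A
  ideal I := I.1.map Polynomial.C
  exists_seq := by
    obtain ⟨s, hs⟩ := OpenIdeal.exists_seq (A := A)
    refine ⟨s, fun I => ?_⟩
    obtain ⟨N, hN⟩ := hs I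
    exact ⟨N, fun n hn => Ideal.map_mono (hN n hn)⟩

/-- The ring `A{T}` of restricted power series, the separated completion of `A[T]`. -/
abbrev RestrictedSeries : Type u := (polySystem A).Compl

namespace RestrictedSeries

/-- The inclusion of the constants. -/
noncomputable def const : A →+* RestrictedSeries A := (polySystem A).of.comp Polynomial.C

/-- The variable. -/
noncomputable def T : RestrictedSeries A := (polySystem A).of Polynomial.X

lemma continuous_const : Continuous (const A) :=
  IdealSystem.continuous_of_isOpen _ _ fun I => ⟨I, fun _ ha =>
    Ideal.Quotient.eq_zero_iff_mem.2 (Ideal.mem_map_of_mem _ ha)⟩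

variable {A} {C : Type u} [CommRing C] [UniformSpace C] [CompleteTopRing C]

/-- The universal property of the ring of restricted power series. -/
lemma exists_eval (φ : A →+* C) (hφ : Continuous φ) (c : C) :
    ∃ k : RestrictedSeries A →+* C, Continuous k ∧ k.comp (const A) = φ ∧ k (T A) = c := by
  have h : (polySystem A).IsCont (Polynomial.eval₂RingHom φ c) := by
    intro K hK
    refine ⟨(⟨K.comap φ, hK.preimage hφ⟩ : OpenIdeal A), ?_⟩
    refine Ideal.map_le_iff_le_comap.2 fun a ha => ?_
    change Polynomial.eval₂ φ c (Polynomial.C a) ∈ K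
    rw [Polynomial.eval₂_C]
    exact ha
  refine ⟨IdealSystem.lift _ h, IdealSystem.continuous_lift _ _, ?_, ?_⟩
  · exact RingHom.ext fun a => (IdealSystem.lift_of _ h _).trans (Polynomial.eval₂_C _ _)
  · exact (IdealSystem.lift_of _ h _).trans (Polynomial.eval₂_X _ _)

lemma hom_ext {k₁ k₂ : RestrictedSeries A →+* C} (h₁ : Continuous k₁) (h₂ : Continuous k₂)
    (hc : k₁.comp (const A) = k₂.comp (const A)) (hT : k₁ (T A) = k₂ (T A)) : k₁ = k₂ :=
  IdealSystem.hom_ext h₁ h₂ (Polynomial.ringHom_ext (fun a => DFunLike.congr_fun hc a) hT)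

end RestrictedSeries

end RestrictedPowerSeries

namespace AffIndScheme

section AdditiveGroup

variable (S : AffIndScheme.{u})

/-- The ring `S.ring{T}` as an affine ind-scheme. -/
noncomputable abbrev gaSpace : AffIndScheme.{u} := ⟨RestrictedSeries S.ring⟩

/-- The structure morphism of the additive group. -/
noncomputable def gaHom : gaSpace S ⟶ S :=
  ofRingHom (X := gaSpace S) (RestrictedSeries.const S.ring)
    (RestrictedSeries.continuous_const S.ring)

/-- The additive group ind-scheme `Spf (A{T})` over `S = Spf A`. -/
noncomputable def Ga : Over S := Over.mk (gaHom S)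

/-- The coordinate function on the additive group. -/
noncomputable def gaT : (Ga S).left.ring := RestrictedSeries.T S.ring

variable {S}

/-- A morphism over `S` to the additive group is determined by the image of `T`. -/
lemma ga_hom_ext {Z : Over S} {f g : Z ⟶ Ga S}
    (h : comorphism f.left (gaT S) = comorphism g.left (gaT S)) : f = g := by
  refine Over.OverMorphism.ext (hom_ext ?_)
  have hf := congrArg comorphism (Over.w f)
  have hg := congrArg comorphism (Over.w g)
  rw [comorphism_comp] at hf hg
  have e : comorphism (Ga S).hom = RestrictedSeries.const S.ring := comorphism_ofRingHom _ _
  rw [e] at hf hg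
  exact RestrictedSeries.hom_ext (continuous_comorphism f.left) (continuous_comorphism g.left)
    (hf.trans hg.symm) h

lemma exists_ga_hom {Z : Over S} (z : Z.left.ring) :
    ∃ f : Z ⟶ Ga S, comorphism f.left (gaT S) = z := by
  obtain ⟨k, hk, hc, hT⟩ := RestrictedSeries.exists_eval (comorphism Z.hom)
    (continuous_comorphism Z.hom) z
  let l : Z.left ⟶ (Ga S).left := ofRingHom (Y := gaSpace S) k hk
  have hl : comorphism l = k := comorphism_ofRingHom (Y := gaSpace S) k hk
  refine ⟨Over.homMk l (hom_ext ?_), ?_⟩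
  · rw [comorphism_comp, hl]
    have e : comorphism (Ga S).hom = RestrictedSeries.const S.ring := comorphism_ofRingHom _ _
    rw [e]
    exact hc
  · exact (DFunLike.congr_fun hl _).trans hT

variable (S) in
/-- The functor `Z ↦ Γ(Z, 𝒪_Z)` on affine ind-schemes over `S`, with values in abelian groups. -/
noncomputable def gaFunctor : (Over S)ᵒᵖ ⥤ AddGrpCat.{u} where
  obj Z := AddGrpCat.of Z.unop.left.ring
  map f := AddGrpCat.ofHom (comorphism f.unop.left).toAddMonoidHom
  map_id Z := by
    refine AddGrpCat.hom_ext (AddMonoidHom.ext fun z => ?_)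
    exact DFunLike.congr_fun (comorphism_id (X := Z.unop.left)) z
  map_comp f g := by
    refine AddGrpCat.hom_ext (AddMonoidHom.ext fun z => ?_)
    exact DFunLike.congr_fun (comorphism_comp g.unop.left f.unop.left) z

variable (S) in
/-- The additive group represents the functor `Z ↦ Γ(Z, 𝒪_Z)`, a morphism `f : Z ⟶ Ga S`
corresponding to the image of `T`. -/
noncomputable def gaRepresentableBy : (gaFunctor S ⋙ forget AddGrpCat).RepresentableBy (Ga S) where
  homEquiv {Z} := Equiv.ofBijective (fun f : Z ⟶ Ga S => comorphism f.left (gaT S))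
    ⟨fun _ _ h => ga_hom_ext h, fun z => exists_ga_hom z⟩
  homEquiv_comp f g := DFunLike.congr_fun (comorphism_comp f.left g.left) (gaT S)

/-- The group structure of the additive group, given by the addition of functions. -/
noncomputable instance : AddGrpObj (Ga S) :=
  AddGrpObj.ofRepresentableBy (Ga S) (gaFunctor S) (gaRepresentableBy S)

open CartesianMonoidalCategory MonoidalCategory AddMonObj

/-- The addition of the additive group is given by `T ↦ T ⊗ 1 + 1 ⊗ T`. -/
lemma comorphism_ga_add :
    comorphism (AddMonObj.add (X := Ga S)).left (gaT S) =
      comorphism (fst (Ga S) (Ga S)).left (gaT S) +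
        comorphism (snd (Ga S) (Ga S)).left (gaT S) :=
  (gaRepresentableBy S).homEquiv.apply_symm_apply _

/-- The zero section of the additive group is given by `T ↦ 0`. -/
lemma comorphism_ga_zero : comorphism (AddMonObj.zero (X := Ga S)).left (gaT S) = 0 :=
  (gaRepresentableBy S).homEquiv.apply_symm_apply _

end AdditiveGroup

end AffIndScheme

/-- Continuous convergence of a sequence `f` of homomorphisms of topological abelian groups to a
homomorphism `g`. -/
def ConvergesContinuously {G G' : Type*} [AddCommGroup G] [TopologicalSpace G] [AddCommGroup G']
    [TopologicalSpace G'] (f : ℕ → G →+ G') (g : G →+ G') : Prop :=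
  (∀ n, Continuous (f n)) ∧ ∀ (x : G) (H' : OpenAddSubgroup G'), ∃ (H : OpenAddSubgroup G) (n₀ : ℕ),
    ∀ h ∈ H, ∀ n ≥ n₀, f n (x + h) - g (x + h) ∈ H'

section HigherDerivations

variable (A B : Type u) [CommRing A] [CommRing B] [TopologicalSpace B] [Algebra A B]

/-- Continuous iterated higher `A`-derivations of a topological `A`-algebra `B`. -/
structure IteratedHigherDerivation where
  D : ℕ → B →L[A] B
  D_zero : D 0 = ContinuousLinearMap.id A B
  leibniz : ∀ (i : ℕ) (b b' : B), D i (b * b') = ∑ j ∈ Finset.range (i + 1), D j b * D (i - j) b'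
  D_comp : ∀ (i j : ℕ) (b : B), D i (D j b) = (i + j).choose i • D (i + j) b

/-- Topologically integrable iterated higher `A`-derivations of `B`. -/
structure TopIntHigherDerivation extends IteratedHigherDerivation A B where
  converges : ConvergesContinuously (fun i => ((D i : B →ₗ[A] B) : B →+ B)) 0

/-- Topologically integrable `A`-derivations of `B`, where `A` contains the field of rational
numbers: the continuous `A`-derivations whose sequence of iterates converges continuously to `0`. -/
structure TopIntDerivation where
  der : Derivation A B B
  continuous_der : Continuous der
  converges : ConvergesContinuously
    (fun i => (((der : B →ₗ[A] B) ^ i : B →ₗ[A] B) : B →+ B)) 0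

end HigherDerivations

namespace AffIndScheme

open CartesianMonoidalCategory MonoidalCategory

section Action

variable {S : AffIndScheme.{u}} (X : Over S)

/-- The pullback of functions along the second projection `𝔾ₐ ×_S X ⟶ X`. -/
noncomputable def sndPullback : X.left.ring →+* (Ga S ⊗ X).left.ring :=
  comorphism (snd (Ga S) X).left

/-- The coordinate function `T` on `𝔾ₐ ×_S X`. -/
noncomputable def coordinate : (Ga S ⊗ X).left.ring := comorphism (fst (Ga S) X).left (gaT S)

/-- Actions of the additive group on an affine ind-scheme `X` over `S`: morphisms
`𝔾ₐ ×_S X ⟶ X` over `S` satisfying the unit and associativity axioms of a group action. -/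
abbrev GaAction : Type u := AddModObj (Ga S) X

variable {X}

/-- The morphism `𝔾ₐ ×_S X ⟶ X` of an action. -/
def GaAction.hom (μ : GaAction X) : Ga S ⊗ X ⟶ X := μ.vadd

/-- The comorphism of an action. -/
noncomputable def GaAction.coaction (μ : GaAction X) : X.left.ring →+* (Ga S ⊗ X).left.ring :=
  comorphism μ.hom.left

end Action

variable {A B : Type u} [CommRing A] [UniformSpace A] [CompleteTopRing A]
  [CommRing B] [UniformSpace B] [CompleteTopRing B] [Algebra A B]

/-- The affine ind-scheme `Spf B` over `Spf A` of a complete topological `A`-algebra `B`. -/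
noncomputable def overSpf (hφ : Continuous (algebraMap A B)) : Over (AffIndScheme.mk A) :=
  Over.mk (ofRingHom (X := AffIndScheme.mk B) (Y := AffIndScheme.mk A) (algebraMap A B) hφ)

end AffIndScheme

/-! The functions on 𝔾ₐ ×_S X form the ring R = B{t} of restricted power series, whose elements are
the series ∑ bᵢ tⁱ with bᵢ → 0 in B. A map f : B → R is therefore a family of maps D⁽ⁱ⁾, the
coefficients of f, and each condition on f becomes a condition on the family. Multiplicativity of f
is the Leibniz rule and compatibility with A is A-linearity. The unit axiom, evaluation at t = 0, is
D⁽⁰⁾ = id. Associativity compares ∑ D⁽ⁿ⁾(b)(t₂ + t)ⁿ with ∑ D⁽ⁱ⁾D⁽ʲ⁾(b) tⁱ t₂ʲ, which is the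
composition rule with binomial coefficients. That f takes values in R is pointwise convergence
D⁽ⁱ⁾(b) → 0, and continuity of f is equicontinuity of the family. Together these two are continuous
convergence to 0 (`convergesContinuously_zero_iff`).

R is never computed as a completed tensor product. It is used only through its universal property
(`IsRestrictedSeries`), which follows from the fibre product and the functor represented by 𝔾ₐ.
Three test rings extract the coefficients. B⟦t⟧ defines them, the discrete rings (B/J)[t] show that
they tend to 0 and are equicontinuous, and the discrete rings R/K show that an element with small
coefficients is small. The axioms are translated in `zero_vadd_iff` and `add_vadd_iff`, and
`exists_isCoaction` rebuilds f from a family.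

Over ℚ, the composition rule gives (D⁽¹⁾)ⁿ = n! D⁽ⁿ⁾, so D⁽¹⁾ determines D. Convergence passes both
ways because open ideals are stable under multiplication by n! and by 1/n!. -/

/-! ### Test rings: discrete rings and formal power series. -/

section CompleteTopRing

/-- A discrete commutative ring is a complete topological ring. -/
lemma CompleteTopRing.of_eq_bot {C : Type u} [CommRing C] [U : UniformSpace C] (h : U = ⊥) :
    CompleteTopRing C := by
  subst h
  let : UniformSpace C := ⊥
  have : DiscreteTopology C := ⟨rfl⟩
  have hb : (𝓝 (0 : C)).HasBasis (fun _ : Unit => True) (fun _ => ((⊥ : Ideal C) : Set C)) := by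
    rw [nhds_discrete, Submodule.bot_coe]
    exact Filter.hasBasis_pure 0
  have i1 : IsUniformAddGroup C := ⟨DiscreteUniformity.uniformContinuous (X := C × C) _⟩
  have i2 : IsLinearTopology C C := IsLinearTopology.mk_of_hasBasis C hb
  exact { i1, i2 with countable_basis := by rw [nhds_discrete]; infer_instance }

/-- Convergent series in a complete topological ring are those whose terms tend to `0`. -/
lemma CompleteTopRing.summable {C : Type u} [CommRing C] [UniformSpace C] [CompleteTopRing C]
    {f : ℕ → C} (h : ∀ I : OpenIdeal C, ∃ N, ∀ n ≥ N, f n ∈ I.1) : Summable f := by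
  have : NonarchimedeanAddGroup C := ⟨fun U hU => by
    obtain ⟨I, hI, hIU⟩ := (IsLinearTopology.hasBasis_open_ideal (R := C)).mem_iff.1 hU
    exact ⟨⟨I.toAddSubgroup, hI⟩, hIU⟩⟩
  refine NonarchimedeanAddGroup.summable_of_tendsto_cofinite_zero ?_
  rw [Nat.cofinite_eq_atTop, (IsLinearTopology.hasBasis_open_ideal (R := C)).tendsto_right_iff]
  intro I hI
  obtain ⟨N, hN⟩ := h ⟨I, hI⟩
  exact Filter.eventually_atTop.2 ⟨N, hN⟩

open PowerSeries.WithPiTopology in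
/-- Formal power series form a complete topological ring for the topology of coefficientwise
convergence. -/
lemma CompleteTopRing.powerSeries (C : Type u) [CommRing C] [UniformSpace C] [CompleteTopRing C] :
    CompleteTopRing (PowerSeries C) := by
  have i1 : IsUniformAddGroup (PowerSeries C) := inferInstance
  have i2 : IsTopologicalRing (PowerSeries C) := inferInstance
  have i3 : IsLinearTopology Cᵐᵒᵖ C := inferInstance
  have i4 : IsLinearTopology (PowerSeries C) (PowerSeries C) :=
    inferInstanceAs (IsLinearTopology (MvPowerSeries Unit C) (MvPowerSeries Unit C))
  have i5 : CompleteSpace (PowerSeries C) := inferInstance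
  have i6 : T2Space (PowerSeries C) := inferInstance
  refine { i1, i2, i4, i5, i6 with countable_basis := ?_ }
  have := CompleteTopRing.countable_basis (A := C)
  -- A power series is a function on the countable set `Unit →₀ ℕ`, and a countable product of
  -- countably generated filters is countably generated.
  have h : 𝓝 (0 : PowerSeries C) = Filter.pi (fun _ : Unit →₀ ℕ => 𝓝 (0 : C)) :=
    nhds_pi (a := (0 : (Unit →₀ ℕ) → C))
  rw [h]
  exact @Filter.pi.isCountablyGenerated _ _ _ _ (fun _ => this)

/-- A homomorphism to a discrete ring is continuous if its kernel contains an open ideal. -/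
lemma continuous_of_isOpen_le_ker {B C : Type*} [CommRing B] [TopologicalSpace B]
    [IsTopologicalRing B] [CommRing C] [TopologicalSpace C] [DiscreteTopology C]
    {f : B →+* C} {L : Ideal B} (hL : IsOpen (L : Set B)) (hf : L ≤ RingHom.ker f) :
    Continuous f := by
  refine continuous_of_continuousAt_zero f.toAddMonoidHom ?_
  change Filter.Tendsto f (𝓝 0) (𝓝 (f 0))
  rw [map_zero, nhds_discrete C, Filter.tendsto_pure]
  filter_upwards [hL.mem_nhds (zero_mem L)] with b hb using hf hb

end CompleteTopRing

/-! ### Restricted power series and their coefficients. -/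

/-- A ring homomorphism `p : B → R` and an element `t` of `R` exhibit `R` as the ring of restricted
power series in `t` over `B` if they satisfy its universal property. -/
structure IsRestrictedSeries {B R : Type u} [CommRing B] [UniformSpace B] [CompleteTopRing B]
    [CommRing R] [UniformSpace R] [CompleteTopRing R] (p : B →+* R) (t : R) : Prop where
  continuous : Continuous p
  exists_hom : ∀ {C : Type u} [CommRing C] [UniformSpace C] [CompleteTopRing C] (g : B →+* C)
    (c : C), Continuous g → ∃ k : R →+* C, Continuous k ∧ k.comp p = g ∧ k t = c
  hom_ext : ∀ {C : Type u} [CommRing C] [UniformSpace C] [CompleteTopRing C] {k l : R →+* C},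
    Continuous k → Continuous l → k.comp p = l.comp p → k t = l t → k = l

namespace IsRestrictedSeries

open PowerSeries.WithPiTopology

variable {B R : Type u} [CommRing B] [UniformSpace B] [CompleteTopRing B]
  [CommRing R] [UniformSpace R] [CompleteTopRing R] {p : B →+* R} {t : R}

/-- The universal property is tested on B⟦t⟧ with the coefficientwise topology. This gives the
elements of R coefficients although nothing is known about R beyond its universal property. -/
lemma exists_expand (h : IsRestrictedSeries p t) : ∃ k : R →+* PowerSeries B,
    Continuous k ∧ k.comp p = PowerSeries.C ∧ k t = PowerSeries.X :=
  have := CompleteTopRing.powerSeries B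
  h.exists_hom _ _ continuous_C

/-- Homomorphisms to a discrete ring are determined by their restriction to `B` and the image
of `t`. -/
lemma hom_ext_of_isOpen_ker (h : IsRestrictedSeries p t) {C : Type u} [CommRing C]
    {k l : R →+* C} {K : Ideal R} (hK : IsOpen (K : Set R)) (hk : K ≤ RingHom.ker k)
    (hl : K ≤ RingHom.ker l)
    (hp : k.comp p = l.comp p) (ht : k t = l t) : k = l := by
  let : UniformSpace C := ⊥
  have : DiscreteTopology C := ⟨rfl⟩
  have : CompleteTopRing C := .of_eq_bot rfl
  exact h.hom_ext (continuous_of_isOpen_le_ker hK hk) (continuous_of_isOpen_le_ker hK hl) hp ht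

variable (h : IsRestrictedSeries p t)

/-- The expansion of an element of `R` as a power series in `t`. -/
noncomputable def expand : R →+* PowerSeries B := h.exists_expand.choose

lemma continuous_expand : Continuous h.expand := h.exists_expand.choose_spec.1

@[simp] lemma expand_map (b : B) : h.expand (p b) = PowerSeries.C b :=
  DFunLike.congr_fun h.exists_expand.choose_spec.2.1 b

@[simp] lemma expand_var : h.expand t = PowerSeries.X := h.exists_expand.choose_spec.2.2

/-- The coefficients of an element of `R`. -/
noncomputable def coeff (i : ℕ) : R →+ B :=
  (PowerSeries.coeff (R := B) i).toAddMonoidHom.comp h.expand.toAddMonoidHom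

lemma coeff_apply (i : ℕ) (x : R) : h.coeff i x = PowerSeries.coeff i (h.expand x) := rfl

lemma continuous_coeff (i : ℕ) : Continuous (h.coeff i) :=
  (PowerSeries.WithPiTopology.continuous_coeff B i).comp h.continuous_expand

lemma coeff_map_mul (i : ℕ) (b : B) (x : R) : h.coeff i (p b * x) = b * h.coeff i x := by
  simp [coeff_apply]

lemma coeff_map_mul_pow (i j : ℕ) (b : B) :
    h.coeff i (p b * t ^ j) = if i = j then b else 0 := by
  simp [coeff_apply, PowerSeries.coeff_X_pow]

lemma coeff_mul (i : ℕ) (x y : R) :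
    h.coeff i (x * y) = ∑ j ∈ Finset.range (i + 1), h.coeff j x * h.coeff (i - j) y := by
  simp only [coeff_apply, map_mul, PowerSeries.coeff_mul]
  exact Finset.Nat.sum_antidiagonal_eq_sum_range_succ
    (fun j k => PowerSeries.coeff j (h.expand x) * PowerSeries.coeff k (h.expand y)) i

/-- Applying a homomorphism with open kernel to the coefficients of the elements of `R` yields
polynomials. -/
lemma exists_map_coeff {C : Type u} [CommRing C] {g : B →+* C}
    (hg : IsOpen (RingHom.ker g : Set B)) : ∃ q : R →+* Polynomial C,
      IsOpen (RingHom.ker q : Set R) ∧ (∀ b, q (p b) = Polynomial.C (g b)) ∧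
        q t = Polynomial.X ∧ ∀ i x, (q x).coeff i = g (h.coeff i x) := by
  let : UniformSpace C := ⊥
  have : DiscreteTopology C := ⟨rfl⟩
  have : CompleteTopRing C := .of_eq_bot rfl
  have := CompleteTopRing.powerSeries C
  -- The discrete topology makes the polynomial ring an admissible target, so the coefficients of an
  -- image are finite in number and the kernel of `q` is open.
  let : UniformSpace (Polynomial C) := ⊥
  have : DiscreteTopology (Polynomial C) := ⟨rfl⟩
  have : CompleteTopRing (Polynomial C) := .of_eq_bot rfl
  have hgc : Continuous g := continuous_of_isOpen_le_ker hg le_rfl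
  obtain ⟨q, hq, hqp, hqt⟩ := h.exists_hom (Polynomial.C.comp g)
    Polynomial.X ((continuous_of_discreteTopology (f := Polynomial.C)).comp hgc)
  refine ⟨q, ?_, fun b => DFunLike.congr_fun hqp b, hqt, fun i x => ?_⟩
  · exact (isOpen_discrete ({0} : Set (Polynomial C))).preimage hq
  -- Both composites are continuous maps from R to C⟦t⟧ that agree on `p` and `t`, so uniqueness
  -- identifies them. Comparing coefficients gives the claim.
  · have key : (Polynomial.coeToPowerSeries.ringHom (R := C)).comp q =
        (PowerSeries.map g).comp h.expand := by
      refine h.hom_ext ((continuous_of_discreteTopology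
        (f := Polynomial.coeToPowerSeries.ringHom (R := C))).comp hq) ?_ ?_ ?_
      · refine continuous_pi fun n => ?_
        exact hgc.comp ((continuous_apply n).comp h.continuous_expand)
      · refine RingHom.ext fun b => ?_
        have := DFunLike.congr_fun hqp b
        simp only [RingHom.comp_apply] at this ⊢
        simp [this]
      · simp [hqt]
    have := congrArg (PowerSeries.coeff i) (DFunLike.congr_fun key x)
    simpa [coeff_apply] using this

/-- The open ideals of `R` are determined by the coefficients. -/
lemma exists_mem_of_coeff_mem (K : OpenIdeal R) :
    ∃ J : OpenIdeal B, ∀ x, (∀ i, h.coeff i x ∈ J.1) → x ∈ K.1 := by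
  let J : OpenIdeal B := ⟨K.1.comap p, K.2.preimage h.continuous⟩
  obtain ⟨q, hq, hqp, hqt, hqc⟩ := h.exists_map_coeff (g := Ideal.Quotient.mk J.1)
    (by rw [Ideal.mk_ker]; exact J.2)
  let r : Polynomial (B ⧸ J.1) →+* R ⧸ K.1 :=
    Polynomial.eval₂RingHom (Ideal.quotientMap K.1 p le_rfl) (Ideal.Quotient.mk K.1 t)
  -- An open ideal killed both by `q` and by the reduction modulo `K` is needed to view the two maps
  -- below as continuous to the discrete ring `R ⧸ K`.
  obtain ⟨L, hLq, hLK⟩ : ∃ L : OpenIdeal R, L.1 ≤ RingHom.ker q ∧ L.1 ≤ K.1 :=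
    ⟨⟨RingHom.ker q ⊓ K.1, hq.inter K.2⟩, inf_le_left, inf_le_right⟩
  -- The reduction modulo `K` factors through (B/J)[t] with J = p⁻¹(K). An element whose
  -- coefficients all lie in J dies already in (B/J)[t].
  have key : r.comp q = Ideal.Quotient.mk K.1 := by
    refine h.hom_ext_of_isOpen_ker L.2 (fun x hx => ?_) (hLK.trans Ideal.mk_ker.ge)
      (RingHom.ext fun b => ?_) ?_
    · rw [RingHom.mem_ker, RingHom.comp_apply, RingHom.mem_ker.1 (hLq hx), map_zero]
    · simp [r, hqp]
    · simp [r, hqt]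
  refine ⟨J, fun x hx => ?_⟩
  have hx0 : q x = 0 := Polynomial.ext fun i => by
    rw [hqc, Polynomial.coeff_zero, Ideal.Quotient.eq_zero_iff_mem]
    exact hx i
  rw [← Ideal.Quotient.eq_zero_iff_mem, ← key, RingHom.comp_apply, hx0, map_zero]

/-- The coefficients of an element of `R` converge to `0`. -/
lemma coeff_mem_of_ge (J : OpenIdeal B) (x : R) : ∃ N, ∀ n ≥ N, h.coeff n x ∈ J.1 := by
  obtain ⟨q, -, -, -, hqc⟩ := h.exists_map_coeff (g := Ideal.Quotient.mk J.1)
    (by rw [Ideal.mk_ker]; exact J.2)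
  -- Modulo `J` the element is a polynomial, and its coefficients vanish strictly beyond the degree.
  refine ⟨(q x).natDegree + 1, fun n hn => ?_⟩
  rw [← Ideal.Quotient.eq_zero_iff_mem, ← hqc]
  exact Polynomial.coeff_eq_zero_of_natDegree_lt hn

/-- The coefficients are equicontinuous. -/
lemma exists_coeff_mem (J : OpenIdeal B) :
    ∃ K : OpenIdeal R, ∀ x ∈ K.1, ∀ i, h.coeff i x ∈ J.1 := by
  obtain ⟨q, hq, -, -, hqc⟩ := h.exists_map_coeff (g := Ideal.Quotient.mk J.1)
    (by rw [Ideal.mk_ker]; exact J.2)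
  -- A single open ideal, the kernel of reduction to (B/J)[t], controls all coefficients at once.
  refine ⟨⟨RingHom.ker q, hq⟩, fun x hx i => ?_⟩
  rw [← Ideal.Quotient.eq_zero_iff_mem, ← hqc, RingHom.mem_ker.1 hx, Polynomial.coeff_zero]

/-- If all coefficients of x − y vanish, then x − y lies in every open ideal by
`exists_mem_of_coeff_mem`, and R is separated. So expansion into a power series is injective. -/
lemma ext {x y : R} (hxy : ∀ i, h.coeff i x = h.coeff i y) : x = y := by
  rw [← sub_eq_zero]
  refine OpenIdeal.eq_zero_of_forall_mem fun K => ?_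
  obtain ⟨J, hJ⟩ := h.exists_mem_of_coeff_mem K
  refine hJ _ fun i => ?_
  rw [map_sub, hxy, sub_self]
  exact zero_mem _

/-- An element of `R` is the sum of its power series expansion. -/
lemma hasSum_of_coeff {d : ℕ → B} {x : R} (hx : ∀ i, h.coeff i x = d i) :
    HasSum (fun i => p (d i) * t ^ i) x := by
  have hs : Summable fun i => p (d i) * t ^ i := by
    refine CompleteTopRing.summable fun K => ?_
    obtain ⟨N, hN⟩ := h.coeff_mem_of_ge ⟨K.1.comap p, K.2.preimage h.continuous⟩ x
    exact ⟨N, fun n hn => K.1.mul_mem_right _ (hx n ▸ hN n hn)⟩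
  obtain ⟨y, hy⟩ := hs
  -- The series converges to some y because R is complete. Continuity of the coefficients computes
  -- those of y term by term, and they are those of x.
  have : x = y := h.ext fun i => by
    refine (hx i).trans (HasSum.unique ?_ (hy.map (h.coeff i) (h.continuous_coeff i)))
    convert hasSum_ite_eq i (d i) using 2 with j
    simp only [Function.comp_apply, coeff_map_mul_pow, eq_comm]
    split_ifs with hij <;> simp [hij]
  rwa [this]

/-- A sequence converging to `0` is the sequence of coefficients of an element of `R`. -/
lemma exists_coeff_eq {d : ℕ → B} (hd : ∀ J : OpenIdeal B, ∃ N, ∀ n ≥ N, d n ∈ J.1) :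
    ∃ x : R, ∀ i, h.coeff i x = d i := by
  have hs : Summable fun i => p (d i) * t ^ i := by
    refine CompleteTopRing.summable fun K => ?_
    obtain ⟨N, hN⟩ := hd ⟨K.1.comap p, K.2.preimage h.continuous⟩
    exact ⟨N, fun n hn => K.1.mul_mem_right _ (hN n hn)⟩
  obtain ⟨y, hy⟩ := hs
  refine ⟨y, fun i => (hy.map (h.coeff i) (h.continuous_coeff i)).unique ?_⟩
  convert hasSum_ite_eq i (d i) using 2 with j
  simp only [Function.comp_apply, coeff_map_mul_pow, eq_comm]
  split_ifs with hij <;> simp [hij]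

/-- The homomorphism `x ↦ x(0)`. -/
lemma hom_eq_coeff_zero {k : R →+* B} (hk : Continuous k) (hp : k.comp p = RingHom.id B)
    (ht : k t = 0) (x : R) : k x = h.coeff 0 x := by
  -- Taking the constant term is another continuous homomorphism that is the identity on B and kills
  -- `t`.
  have : k = PowerSeries.constantCoeff.comp h.expand :=
    h.hom_ext hk ((PowerSeries.WithPiTopology.continuous_constantCoeff B).comp
      h.continuous_expand) (hp.trans (RingHom.ext fun b => by simp)) (by simp [ht])
  rw [this, coeff_apply, PowerSeries.coeff_zero_eq_constantCoeff]
  rfl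

end IsRestrictedSeries

/-! ### Continuous convergence to zero as equicontinuity with pointwise convergence. -/

section Convergence

variable {B : Type u} [CommRing B] [UniformSpace B] [CompleteTopRing B]

lemma OpenIdeal.exists_le_openAddSubgroup (H : OpenAddSubgroup B) :
    ∃ J : OpenIdeal B, ∀ x ∈ J.1, x ∈ H := by
  obtain ⟨J, hJ, hJH⟩ := (IsLinearTopology.hasBasis_open_ideal (R := B)).mem_iff.1
    (H.isOpen.mem_nhds (zero_mem H))
  exact ⟨⟨J, hJ⟩, hJH⟩

/-- A sequence of homomorphisms converges continuously to `0` if and only if it is equicontinuous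
and converges pointwise to `0`. -/
lemma convergesContinuously_zero_iff {f : ℕ → B →+ B} :
    ConvergesContinuously f 0 ↔ ∀ J : OpenIdeal B, (∀ x, ∃ N, ∀ n ≥ N, f n x ∈ J.1) ∧
      ∃ K : OpenIdeal B, ∀ x ∈ K.1, ∀ n, f n x ∈ J.1 := by
  constructor
  · rintro ⟨hc, hf⟩ J
    have hf' := fun x => hf x ⟨J.1.toAddSubgroup, J.2⟩
    refine ⟨fun x => ?_, ?_⟩
    · obtain ⟨H, N, hN⟩ := hf' x
      refine ⟨N, fun n hn => ?_⟩
      have := hN 0 (zero_mem H) n hn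
      rwa [add_zero, AddMonoidHom.zero_apply, sub_zero] at this
    -- Convergence at 0 controls all n ≥ N on one neighbourhood. The finitely many remaining maps
    -- are handled by their individual continuity, through a finite intersection.
    · obtain ⟨H, N, hN⟩ := hf' 0
      have hU : (⋂ n ∈ Finset.range N, f n ⁻¹' (J.1 : Set B)) ∩ H ∈ 𝓝 (0 : B) := by
        refine Filter.inter_mem ((Filter.biInter_finset_mem _).2 fun n _ => ?_)
          (H.isOpen.mem_nhds (zero_mem H))
        refine (J.2.preimage (hc n)).mem_nhds ?_
        rw [Set.mem_preimage, map_zero]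
        exact zero_mem J.1
      obtain ⟨K, hK, hKU⟩ := (IsLinearTopology.hasBasis_open_ideal (R := B)).mem_iff.1 hU
      refine ⟨⟨K, hK⟩, fun x hx n => ?_⟩
      obtain ⟨h1, h2⟩ := hKU hx
      rcases lt_or_ge n N with hn | hn
      · exact Set.mem_iInter₂.1 h1 n (Finset.mem_range.2 hn)
      · have := hN x h2 n hn
        rwa [zero_add, AddMonoidHom.zero_apply, sub_zero] at this
  · intro hf
    refine ⟨fun n => ?_, fun x H' => ?_⟩
    · refine continuous_of_continuousAt_zero (f n) ?_
      change Filter.Tendsto (f n) (𝓝 0) (𝓝 (f n 0))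
      rw [map_zero, (IsLinearTopology.hasBasis_open_ideal (R := B)).tendsto_right_iff]
      intro J hJ
      obtain ⟨-, K, hK⟩ := hf ⟨J, hJ⟩
      filter_upwards [K.2.mem_nhds (zero_mem K.1)] with y hy using hK y hy n
    · obtain ⟨J, hJ⟩ := OpenIdeal.exists_le_openAddSubgroup H'
      obtain ⟨hx, K, hK⟩ := hf J
      obtain ⟨N, hN⟩ := hx x
      refine ⟨⟨K.1.toAddSubgroup, K.2⟩, N, fun y hy n hn => hJ _ ?_⟩
      rw [AddMonoidHom.zero_apply, sub_zero, map_add]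
      exact add_mem (hN n hn) (hK y hy n)

end Convergence

/-! ### Higher derivations and iterates of a derivation. -/

section HigherDerivations

variable {A B : Type u} [CommRing A] [CommRing B] [Algebra A B]

/-- The Leibniz rule for the iterates of a derivation. -/
lemma Derivation.iterate_apply_mul (D : Derivation A B B) (n : ℕ) (a b : B) :
    D^[n] (a * b) =
      ∑ ij ∈ Finset.HasAntidiagonal.antidiagonal n, n.choose ij.1 • (D^[ij.1] a * D^[ij.2] b) := by
  induction n with
  | zero => simp
  | succ n ih =>
    rw [Finset.sum_antidiagonal_choose_succ_nsmul (M := B) (fun i j => D^[i] a * D^[j] b) n]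
    simp only [Function.iterate_succ_apply', ih, map_sum, map_nsmul, D.leibniz, smul_add,
      Finset.sum_add_distrib, smul_eq_mul, add_right_inj]
    -- Pascal's rule has split the sum in two. The halves still to be matched differ by the symmetry
    -- of the binomial coefficient and the order of the factors.
    refine Finset.sum_congr rfl fun ⟨i, j⟩ hij => ?_
    rw [n.choose_symm_of_eq_add (Finset.HasAntidiagonal.mem_antidiagonal.1 hij).symm, mul_comm]

namespace IteratedHigherDerivation

variable [TopologicalSpace B]

/-- The case i = 1 of the composition rule reads D⁽¹⁾D⁽ⁿ⁾ = (n + 1) D⁽ⁿ⁺¹⁾. No division is involved,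
so this holds over any A. -/
lemma iterate_D_one (D : IteratedHigherDerivation A B) (n : ℕ) (b : B) :
    (D.D 1)^[n] b = n.factorial • D.D n b := by
  induction n with
  | zero => simp [D.D_zero]
  | succ n ih =>
    rw [Function.iterate_succ_apply', ih, map_nsmul, D.D_comp, smul_smul, add_comm 1 n,
      Nat.choose_one_right, Nat.factorial_succ, mul_comm]

/-- The derivation `D⁽¹⁾`. -/
def derivation (D : IteratedHigherDerivation A B) : Derivation A B B :=
  Derivation.mk' (D.D 1 : B →ₗ[A] B) fun a b => by
    simp [D.leibniz, Finset.sum_range_succ, D.D_zero, mul_comm b]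

lemma coe_derivation (D : IteratedHigherDerivation A B) : ⇑D.derivation = D.D 1 := rfl

end IteratedHigherDerivation

@[ext] lemma TopIntHigherDerivation.ext [TopologicalSpace B] {D E : TopIntHigherDerivation A B}
    (h : ∀ n b, D.D n b = E.D n b) : D = E := by
  obtain ⟨⟨D, _, _, _⟩, _⟩ := D
  obtain ⟨⟨E, _, _, _⟩, _⟩ := E
  have : D = E := funext fun n => ContinuousLinearMap.ext (h n)
  subst this
  rfl

@[ext] lemma TopIntDerivation.ext [TopologicalSpace B] {D E : TopIntDerivation A B}
    (h : ∀ b, D.der b = E.der b) : D = E := by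
  obtain ⟨D, _, _⟩ := D
  obtain ⟨E, _, _⟩ := E
  have : D = E := Derivation.ext h
  subst this
  rfl

/-! ### Divided powers of a derivation over the rational numbers. -/

section Rat

variable [Algebra ℚ A]

/-- The homomorphisms `∂ⁿ / n!`. -/
noncomputable def Derivation.dividedPow (D : Derivation A B B) (n : ℕ) : B →ₗ[A] B :=
  algebraMap ℚ A (1 / (n.factorial : ℚ)) • (D : B →ₗ[A] B) ^ n

lemma Derivation.dividedPow_apply (D : Derivation A B B) (n : ℕ) (b : B) :
    D.dividedPow n b = algebraMap ℚ A (1 / (n.factorial : ℚ)) • D^[n] b :=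
  congrArg (fun x : B => algebraMap ℚ A (1 / (n.factorial : ℚ)) • x)
    (Module.End.pow_apply (D : B →ₗ[A] B) n b)

/-- This is the Leibniz rule for iterates divided by n!, since the binomial coefficient of n = i + j
over n! is 1/(i! j!). -/
lemma Derivation.dividedPow_mul (D : Derivation A B B) (n : ℕ) (a b : B) :
    D.dividedPow n (a * b) =
      ∑ j ∈ Finset.range (n + 1), D.dividedPow j a * D.dividedPow (n - j) b := by
  -- Rational scalars are made to act on B through A, so that the coefficients can be compared in ℚ.
  let : Algebra ℚ B := ((algebraMap A B).comp (algebraMap ℚ A)).toAlgebra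
  have hs : ∀ (q : ℚ) (x : B), algebraMap ℚ A q • x = q • x := fun q x => by
    rw [Algebra.smul_def, Algebra.smul_def]; rfl
  rw [← Finset.Nat.sum_antidiagonal_eq_sum_range_succ
    (fun i j => D.dividedPow i a * D.dividedPow j b) n]
  simp only [dividedPow_apply, hs, iterate_apply_mul, Finset.smul_sum]
  refine Finset.sum_congr rfl fun ⟨i, j⟩ hij => ?_
  obtain rfl : i + j = n := Finset.HasAntidiagonal.mem_antidiagonal.1 hij
  rw [smul_mul_smul_comm, ← Nat.cast_smul_eq_nsmul ℚ, smul_smul]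
  congr 1
  have h : ((i + j).choose i : ℚ) * i.factorial * j.factorial = (i + j).factorial :=
    mod_cast Nat.choose_symm_add (a := i) ▸ Nat.add_choose_mul_factorial_mul_factorial i j
  have := Nat.cast_ne_zero (R := ℚ).2 i.factorial_ne_zero
  have := Nat.cast_ne_zero (R := ℚ).2 j.factorial_ne_zero
  have := Nat.cast_ne_zero (R := ℚ).2 (i + j).factorial_ne_zero
  field_simp
  rw [← h]

/-- Iterates of ∂ add their exponents and commute with scalars of A. What remains is the factorial
formula for the binomial coefficient. -/
lemma Derivation.dividedPow_dividedPow (D : Derivation A B B) (i j : ℕ) (b : B) :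
    D.dividedPow i (D.dividedPow j b) = (i + j).choose i • D.dividedPow (i + j) b := by
  have hc : ∀ (c : A) (n : ℕ) (x : B), D^[n] (c • x) = c • D^[n] x := fun c n x =>
    (Module.End.pow_apply (D : B →ₗ[A] B) n _).symm.trans
      ((((D : B →ₗ[A] B) ^ n).map_smul c x).trans
        (congrArg (c • ·) (Module.End.pow_apply (D : B →ₗ[A] B) n x)))
  rw [dividedPow_apply, dividedPow_apply, dividedPow_apply, hc, ← Function.iterate_add_apply,
    smul_smul, ← map_mul, ← Nat.cast_smul_eq_nsmul A, smul_smul,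
    ← _root_.map_natCast (algebraMap ℚ A) ((i + j).choose i), ← map_mul]
  congr 2
  have h : ((i + j).choose i : ℚ) * i.factorial * j.factorial = (i + j).factorial :=
    mod_cast Nat.choose_symm_add (a := i) ▸ Nat.add_choose_mul_factorial_mul_factorial i j
  have := Nat.cast_ne_zero (R := ℚ).2 i.factorial_ne_zero
  have := Nat.cast_ne_zero (R := ℚ).2 j.factorial_ne_zero
  have := Nat.cast_ne_zero (R := ℚ).2 (i + j).factorial_ne_zero
  field_simp
  rw [← h]
  ring

/-- Inverting n! in `iterate_D_one` recovers every component from the first one. This is the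
injectivity half of the second bijection. -/
lemma IteratedHigherDerivation.D_eq_dividedPow [TopologicalSpace B]
    (D : IteratedHigherDerivation A B) (n : ℕ) (b : B) :
    D.D n b = D.derivation.dividedPow n b := by
  have h : (algebraMap ℚ A (1 / (n.factorial : ℚ))) * (n.factorial : A) = 1 := by
    rw [← map_natCast (algebraMap ℚ A), ← map_mul, one_div_mul_cancel
      (Nat.cast_ne_zero.2 n.factorial_ne_zero), map_one]
  rw [Derivation.dividedPow_apply, D.coe_derivation, D.iterate_D_one,
    ← Nat.cast_smul_eq_nsmul A, smul_smul, h, one_smul]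

end Rat

variable [UniformSpace B] [CompleteTopRing B]

/-- The topologically integrable derivation `D⁽¹⁾`. -/
def TopIntHigherDerivation.topIntDerivation (D : TopIntHigherDerivation A B) :
    TopIntDerivation A B where
  der := D.derivation
  continuous_der := (D.D 1).continuous
  converges := by
    have e : ∀ (n : ℕ) (b : B), ((D.derivation : B →ₗ[A] B) ^ n) b = n.factorial • D.D n b :=
      fun n b => (Module.End.pow_apply _ _ _).trans (D.iterate_D_one n b)
    refine convergesContinuously_zero_iff.2 fun J => ?_
    -- The n-th iterate is n! times the n-th component, and `J` is closed under integer multiples,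
    -- so the same bounds serve.
    obtain ⟨h, K, hK⟩ := convergesContinuously_zero_iff.1 D.converges J
    refine ⟨fun x => (h x).imp fun N hN n hn => ?_, K, fun x hx n => ?_⟩
    · exact (e n x).symm ▸ nsmul_mem (hN n hn) _
    · exact (e n x).symm ▸ nsmul_mem (hK x hx n) _

variable [Algebra ℚ A]

/-- The scalars 1/n! come from A, and open ideals of B absorb multiplication by A. So the
denominators cost nothing. -/
lemma TopIntDerivation.convergesContinuously_dividedPow (D : TopIntDerivation A B) :
    ConvergesContinuously (fun n => (D.der.dividedPow n : B →+ B)) 0 := by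
  refine convergesContinuously_zero_iff.2 fun J => ?_
  obtain ⟨h, K, hK⟩ := convergesContinuously_zero_iff.1 D.converges J
  have hJ : ∀ (a : A) (x : B), x ∈ J.1 → a • x ∈ J.1 := fun a x hx => by
    rw [Algebra.smul_def]
    exact J.1.mul_mem_left _ hx
  exact ⟨fun x => (h x).imp fun N hN n hn => hJ _ _ (hN n hn), K,
    fun x hx n => hJ _ _ (hK x hx n)⟩

/-- The topologically integrable iterated higher derivation `∂ⁿ / n!`. -/
noncomputable def TopIntDerivation.topIntHigherDerivation (D : TopIntDerivation A B) :
    TopIntHigherDerivation A B where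
  D n := ⟨D.der.dividedPow n, D.convergesContinuously_dividedPow.1 n⟩
  D_zero := ContinuousLinearMap.ext fun b => (D.der.dividedPow_apply 0 b).trans (by simp)
  leibniz := D.der.dividedPow_mul
  D_comp := D.der.dividedPow_dividedPow
  converges := D.convergesContinuously_dividedPow

/-- Over a `ℚ`-algebra, topologically integrable iterated higher derivations correspond to
topologically integrable derivations. -/
noncomputable def topIntHigherDerivationEquiv :
    TopIntHigherDerivation A B ≃ TopIntDerivation A B where
  toFun D := D.topIntDerivation
  invFun D := D.topIntHigherDerivation
  left_inv D := TopIntHigherDerivation.ext fun n b => (D.D_eq_dividedPow n b).symm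
  right_inv D := TopIntDerivation.ext fun b => (D.der.dividedPow_apply 1 b).trans (by simp)

end HigherDerivations

/-! ### Coactions in terms of coefficients. -/

section Coaction

variable {A B R : Type u} [CommRing A] [CommRing B] [UniformSpace B] [CompleteTopRing B]
  [CommRing R] [UniformSpace R] [CompleteTopRing R] [Algebra A B] {p : B →+* R} {t : R}

namespace IsRestrictedSeries

section

variable {R₂ : Type u} [CommRing R₂] [UniformSpace R₂] [CompleteTopRing R₂] {p₂ : R →+* R₂}
  {t₂ : R₂}

/-- Such a `k` sends ∑ xᵢ tⁱ to ∑ f(xᵢ) t₂ⁱ. When `f` is the comorphism of a map γ : 𝔾ₐ ×_S X → X,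
this is the comorphism of id × γ. -/
lemma coeff_of_comp_eq (h : IsRestrictedSeries p t) (h₂ : IsRestrictedSeries p₂ t₂)
    {f : B →+* R} {k : R →+* R₂} (hk : Continuous k) (hp : k.comp p = p₂.comp f) (ht : k t = t₂)
    (i : ℕ) (x : R) : h₂.coeff i (k x) = f (h.coeff i x) := by
  have hx := (h.hasSum_of_coeff (x := x) fun _ => rfl).map
    ((h₂.coeff i).comp k.toAddMonoidHom) ((h₂.continuous_coeff i).comp hk)
  refine hx.unique ?_
  convert hasSum_ite_eq i (f (h.coeff i x)) using 2 with j
  have e : k (p (h.coeff j x)) = p₂ (f (h.coeff j x)) := DFunLike.congr_fun hp _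
  simp only [Function.comp_apply, AddMonoidHom.comp_apply, RingHom.toAddMonoidHom_eq_coe,
    AddMonoidHom.coe_coe, map_mul, map_pow, ht, e, coeff_map_mul_pow, eq_comm (a := i)]
  split_ifs with hij <;> simp [hij]

/-- Such a `k` sends ∑ xₙ tⁿ to ∑ xₙ (t₂ + t)ⁿ, as the group law does. The formula is the
coefficient of tⁱ t₂ʲ, read off from the binomial theorem. -/
lemma coeff_coeff_of_var_add (h : IsRestrictedSeries p t) (h₂ : IsRestrictedSeries p₂ t₂)
    {k : R →+* R₂} (hk : Continuous k) (hp : k.comp p = p₂.comp p) (ht : k t = t₂ + p₂ t)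
    (i j : ℕ) (x : R) :
    h.coeff i (h₂.coeff j (k x)) = (i + j).choose i • h.coeff (i + j) x := by
  have hx := (h.hasSum_of_coeff (x := x) fun _ => rfl).map
    (((h.coeff i).comp (h₂.coeff j)).comp k.toAddMonoidHom)
    (((h.continuous_coeff i).comp (h₂.continuous_coeff j)).comp hk)
  refine hx.unique ?_
  convert hasSum_ite_eq (i + j) ((i + j).choose i • h.coeff (i + j) x) using 2 with n
  have e : k (p (h.coeff n x) * t ^ n) = ∑ m ∈ Finset.range (n + 1),
      p₂ (p (n.choose m • h.coeff n x) * t ^ (n - m)) * t₂ ^ m := by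
    have hc : k (p (h.coeff n x)) = p₂ (p (h.coeff n x)) := DFunLike.congr_fun hp _
    rw [map_mul, map_pow, ht, hc, add_pow, Finset.mul_sum]
    refine Finset.sum_congr rfl fun m _ => ?_
    simp only [nsmul_eq_mul, map_mul, map_pow, map_natCast]
    ring
  simp only [Function.comp_apply, AddMonoidHom.comp_apply, RingHom.toAddMonoidHom_eq_coe,
    AddMonoidHom.coe_coe, e, map_sum, coeff_map_mul_pow, apply_ite (h.coeff i), map_zero,
    Finset.sum_ite_eq, Finset.mem_range]
  -- The term of degree n contributes only for m = j ≤ n and n − m = i. The bound on m matters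
  -- because the subtraction is truncated.
  by_cases hn : n = i + j
  · subst hn
    rw [if_pos (by lia), if_pos (by lia), if_pos rfl, Nat.choose_symm_add]
  · rw [if_neg hn]
    split_ifs <;> first | rfl | lia

end

end IsRestrictedSeries

variable (A) in
/-- The coactions of the additive group, in terms of the coefficients. -/
structure IsRestrictedSeries.IsCoaction (h : IsRestrictedSeries p t) (f : B →+* R) : Prop where
  continuous : Continuous f
  comp_algebraMap : f.comp (algebraMap A B) = p.comp (algebraMap A B)
  coeff_zero : ∀ b, h.coeff 0 (f b) = b
  coeff_coeff : ∀ i j b, h.coeff i (f (h.coeff j (f b))) =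
    (i + j).choose i • h.coeff (i + j) (f b)

namespace IsRestrictedSeries

variable {h : IsRestrictedSeries p t}

/-- The higher derivation associated to a coaction. -/
noncomputable def IsCoaction.higherDerivation {f : B →+* R} (hf : h.IsCoaction A f) :
    TopIntHigherDerivation A B where
  D i :=
    { toFun := fun b => h.coeff i (f b)
      map_add' := fun b b' => by rw [map_add, map_add]
      map_smul' := fun a b => by
        have : f (algebraMap A B a) = p (algebraMap A B a) :=
          DFunLike.congr_fun hf.comp_algebraMap a
        rw [Algebra.smul_def, map_mul, this, coeff_map_mul, RingHom.id_apply, Algebra.smul_def]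
      cont := (h.continuous_coeff i).comp hf.continuous }
  D_zero := ContinuousLinearMap.ext hf.coeff_zero
  leibniz i b b' := (congrArg (h.coeff i) (map_mul f b b')).trans (h.coeff_mul i _ _)
  D_comp := hf.coeff_coeff
  converges := by
    -- Pointwise convergence holds because each f(b) is a restricted series. Equicontinuity is that
    -- of the coefficients, pulled back along the continuous map `f`.
    refine convergesContinuously_zero_iff.2 fun J => ⟨fun b => h.coeff_mem_of_ge J (f b), ?_⟩
    obtain ⟨K, hK⟩ := h.exists_coeff_mem J
    exact ⟨⟨K.1.comap f, K.2.preimage hf.continuous⟩, fun b hb n => hK _ hb n⟩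

/-- Every topologically integrable iterated higher derivation comes from a coaction. -/
lemma exists_isCoaction (h : IsRestrictedSeries p t) (D : TopIntHigherDerivation A B) :
    ∃ f : B →+* R, h.IsCoaction A f ∧ ∀ i b, h.coeff i (f b) = D.D i b := by
  have hD := convergesContinuously_zero_iff.1 D.converges
  -- Pointwise convergence of the family is exactly what makes ∑ D⁽ⁱ⁾(b) tⁱ an element of R.
  choose f hf using fun b => h.exists_coeff_eq (d := fun i => D.D i b) fun J => (hD J).1 b
  have hmul : ∀ b b', f (b * b') = f b * f b' := fun b b' => h.ext fun i => by
    rw [hf, D.leibniz, h.coeff_mul]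
    simp only [hf]
  -- The vanishing of D⁽ⁱ⁾(1) for i > 0 is not among the axioms. The series of f(1) is idempotent
  -- with constant term 1, hence a unit, hence equal to 1.
  have hone : f 1 = 1 := by
    have hu : IsUnit (h.expand (f 1)) := by
      rw [PowerSeries.isUnit_iff_constantCoeff, ← PowerSeries.coeff_zero_eq_constantCoeff_apply,
        ← coeff_apply, hf, D.D_zero]
      exact isUnit_one
    have he : h.expand (f 1) = 1 := hu.mul_left_cancel (by rw [← map_mul, ← hmul, mul_one, mul_one])
    exact h.ext fun i => by rw [coeff_apply, coeff_apply, he, map_one h.expand]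
  let F : B →+* R :=
    { toFun := f
      map_one' := hone
      map_mul' := hmul
      map_zero' := h.ext fun i => by rw [hf, map_zero, map_zero]
      map_add' := fun b b' => h.ext fun i => by rw [hf, map_add, map_add, hf, hf] }
  have hF : ∀ i b, h.coeff i (F b) = D.D i b := fun i b => hf b i
  refine ⟨F, ⟨?_, RingHom.ext fun a => h.ext fun i => ?_, fun b => ?_, fun i j b => ?_⟩, hF⟩
  -- Here the equicontinuity half of the convergence is used: coefficients uniformly in `J` force
  -- the element into `K`.
  · refine continuous_of_continuousAt_zero F.toAddMonoidHom ?_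
    change Filter.Tendsto F (𝓝 0) (𝓝 (F 0))
    rw [map_zero, (IsLinearTopology.hasBasis_open_ideal (R := R)).tendsto_right_iff]
    intro K hK
    obtain ⟨J, hJ⟩ := h.exists_mem_of_coeff_mem ⟨K, hK⟩
    obtain ⟨-, L, hL⟩ := hD J
    filter_upwards [L.2.mem_nhds (zero_mem L.1)] with b hb
    refine hJ _ fun i => ?_
    rw [hF]
    exact hL b hb i
  -- By A-linearity of the components, compatibility with A reduces to the value at 1.
  · have e : F 1 = p 1 := hone.trans (map_one p).symm
    rw [RingHom.comp_apply, RingHom.comp_apply, hF, Algebra.algebraMap_eq_smul_one, map_smul,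
      ← hF, e, ← Algebra.algebraMap_eq_smul_one, Algebra.smul_def, ← h.coeff_map_mul,
      ← map_mul, mul_one]
  · rw [hF, D.D_zero]; rfl
  · rw [hF, hF, hF, D.D_comp]

end IsRestrictedSeries

end Coaction

/-! ### Translation of the action axioms into coefficients. -/

namespace AffIndScheme

open CartesianMonoidalCategory MonoidalCategory AddMonObj

variable {S : AffIndScheme.{u}}

lemma comorphism_left_comp {X Y Z : Over S} (f : X ⟶ Y) (g : Y ⟶ Z) :
    comorphism (f ≫ g).left = (comorphism f.left).comp (comorphism g.left) :=
  comorphism_comp f.left g.left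

lemma over_hom_ext {X Y : Over S} {f g : X ⟶ Y} (h : comorphism f.left = comorphism g.left) :
    f = g :=
  Over.OverMorphism.ext (hom_ext h)

lemma comorphism_comp_hom {X Y : Over S} (f : X ⟶ Y) :
    (comorphism f.left).comp (comorphism Y.hom) = comorphism X.hom := by
  rw [← comorphism_comp, Over.w]

variable (X : Over S)

/-- The functions on `𝔾ₐ ×_S X` are the restricted power series in `T` over the functions
on `X`. -/
lemma isRestrictedSeries : IsRestrictedSeries (sndPullback X) (coordinate X) where
  continuous := continuous_comorphism _
  exists_hom {C} _ _ _ g c hg := by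
    -- Through `g`, Spf C becomes an object over S with a map to X. The element `c` is a map to 𝔾ₐ,
    -- and the pair gives a map to the product.
    let w : AffIndScheme.mk C ⟶ X.left := ofRingHom (X := AffIndScheme.mk C) g hg
    have hw : comorphism w = g := comorphism_ofRingHom (X := AffIndScheme.mk C) g hg
    let W : Over S := Over.mk (w ≫ X.hom)
    let v : W ⟶ X := Over.homMk w rfl
    obtain ⟨a, ha⟩ := exists_ga_hom (Z := W) c
    refine ⟨comorphism (lift a v).left, continuous_comorphism _, ?_, ?_⟩
    · refine (comorphism_left_comp (lift a v) (snd (Ga S) X)).symm.trans ?_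
      rw [lift_snd]
      exact hw
    · refine (DFunLike.congr_fun (comorphism_left_comp (lift a v) (fst (Ga S) X))
        (gaT S)).symm.trans ?_
      rw [lift_fst]
      exact ha
  hom_ext {C} _ _ _ k l hk hl hp ht := by
    let v : AffIndScheme.mk C ⟶ (Ga S ⊗ X).left := ofRingHom (X := AffIndScheme.mk C) k hk
    let w : AffIndScheme.mk C ⟶ (Ga S ⊗ X).left := ofRingHom (X := AffIndScheme.mk C) l hl
    have hv : comorphism v = k := comorphism_ofRingHom (X := AffIndScheme.mk C) k hk
    have hw : comorphism w = l := comorphism_ofRingHom (X := AffIndScheme.mk C) l hl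
    let W : Over S := Over.mk (v ≫ (Ga S ⊗ X).hom)
    have hp' : (comorphism v).comp (sndPullback X) = (comorphism w).comp (sndPullback X) := by
      rw [hv, hw, hp]
    let v' : W ⟶ Ga S ⊗ X := Over.homMk v rfl
    -- The structure morphism of `W` is defined through `v`. That `w` also respects it follows
    -- because the product maps to S through X, where the two maps agree.
    let w' : W ⟶ Ga S ⊗ X := Over.homMk w (hom_ext (by
      change comorphism (w ≫ (Ga S ⊗ X).hom) = comorphism (v ≫ (Ga S ⊗ X).hom)
      rw [comorphism_comp, comorphism_comp, ← comorphism_comp_hom (snd (Ga S) X),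
        ← RingHom.comp_assoc, ← RingHom.comp_assoc]
      exact congrArg (fun f => RingHom.comp f (comorphism X.hom)) hp'.symm))
    have e : v' = w' := by
      refine CartesianMonoidalCategory.hom_ext _ _ (ga_hom_ext ?_) (over_hom_ext ?_)
      · rw [comorphism_left_comp, comorphism_left_comp]
        change comorphism v (coordinate X) = comorphism w (coordinate X)
        rw [hv, hw, ht]
      · rw [comorphism_left_comp, comorphism_left_comp]
        exact hp'
    rw [← hv, ← hw]
    exact congrArg (fun f : W ⟶ Ga S ⊗ X => comorphism f.left) e

variable {X}

/-- The unit axiom of an action in terms of coefficients. -/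
lemma zero_vadd_iff (γ : Ga S ⊗ X ⟶ X) : ζ[Ga S] ▷ X ≫ γ = (λ_ X).hom ↔
    ∀ b, (isRestrictedSeries X).coeff 0 (comorphism γ.left b) = b := by
  -- This is the zero section of 𝔾ₐ ×_S X over X. Its comorphism is evaluation at t = 0, that is,
  -- the coefficient of index 0.
  let s : X ⟶ Ga S ⊗ X := (λ_ X).inv ≫ ζ[Ga S] ▷ X
  have hp : (comorphism s.left).comp (sndPullback X) = RingHom.id X.left.ring := by
    have e : s ≫ snd (Ga S) X = 𝟙 X := by simp [s]
    refine (comorphism_left_comp s (snd (Ga S) X)).symm.trans ?_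
    rw [e]
    exact comorphism_id
  have ht : comorphism s.left (coordinate X) = 0 := by
    have e : s ≫ fst (Ga S) X = toUnit X ≫ ζ[Ga S] := by simp [s]
    refine (DFunLike.congr_fun (comorphism_left_comp s (fst (Ga S) X)) (gaT S)).symm.trans ?_
    rw [e, comorphism_left_comp, RingHom.comp_apply, comorphism_ga_zero, map_zero]
  have hs := (isRestrictedSeries X).hom_eq_coeff_zero (continuous_comorphism s.left) hp ht
  rw [← Iso.inv_comp_eq_id, ← Category.assoc]
  change s ≫ γ = 𝟙 X ↔ _
  simp only [← hs]
  constructor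
  · intro h b
    have := congrArg (fun f : X ⟶ X => comorphism f.left) h
    simp only [comorphism_left_comp] at this
    exact (DFunLike.congr_fun this b).trans (DFunLike.congr_fun comorphism_id b)
  · intro h
    refine over_hom_ext ?_
    rw [comorphism_left_comp]
    exact (RingHom.ext h).trans comorphism_id.symm

/-- The associativity axiom of an action in terms of coefficients. -/
lemma add_vadd_iff (γ : Ga S ⊗ X ⟶ X) :
    σ[Ga S] ▷ X ≫ γ = (α_ (Ga S) (Ga S) X).hom ≫ Ga S ◁ γ ≫ γ ↔
      ∀ i j b, (isRestrictedSeries X).coeff i (comorphism γ.left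
        ((isRestrictedSeries X).coeff j (comorphism γ.left b))) =
          (i + j).choose i • (isRestrictedSeries X).coeff (i + j) (comorphism γ.left b) := by
  -- Bracketing to the right makes the functions on the source restricted series in t₂ over
  -- restricted series in t, so the same description of coefficients applies twice.
  let s : Ga S ⊗ (Ga S ⊗ X) ⟶ Ga S ⊗ X := (α_ (Ga S) (Ga S) X).inv ≫ σ[Ga S] ▷ X
  let r : Ga S ⊗ (Ga S ⊗ X) ⟶ Ga S ⊗ X := Ga S ◁ γ
  let h := isRestrictedSeries X
  let h₂ := isRestrictedSeries (Ga S ⊗ X)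
  have hrp : (comorphism r.left).comp (sndPullback X) =
      (sndPullback (Ga S ⊗ X)).comp (comorphism γ.left) := by
    have e : r ≫ snd (Ga S) X = snd (Ga S) (Ga S ⊗ X) ≫ γ := by simp [r]
    refine (comorphism_left_comp r (snd (Ga S) X)).symm.trans ?_
    rw [e]
    exact comorphism_left_comp _ _
  have hrt : comorphism r.left (coordinate X) = coordinate (Ga S ⊗ X) := by
    have e : r ≫ fst (Ga S) X = fst (Ga S) (Ga S ⊗ X) := by simp [r]
    refine (DFunLike.congr_fun (comorphism_left_comp r (fst (Ga S) X)) (gaT S)).symm.trans ?_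
    rw [e]
    rfl
  have hsp : (comorphism s.left).comp (sndPullback X) =
      (sndPullback (Ga S ⊗ X)).comp (sndPullback X) := by
    have e : s ≫ snd (Ga S) X = snd (Ga S) (Ga S ⊗ X) ≫ snd (Ga S) X := by simp [s]
    refine (comorphism_left_comp s (snd (Ga S) X)).symm.trans ?_
    rw [e]
    exact comorphism_left_comp _ _
  have hst : comorphism s.left (coordinate X) =
      coordinate (Ga S ⊗ X) + sndPullback (Ga S ⊗ X) (coordinate X) := by
    -- Projecting away X reduces the computation to the group law, which gives the sum of the outer
    -- coordinate t₂ and the inner coordinate t.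
    let q : Ga S ⊗ (Ga S ⊗ X) ⟶ Ga S ⊗ Ga S :=
      lift (fst (Ga S) (Ga S ⊗ X)) (snd (Ga S) (Ga S ⊗ X) ≫ fst (Ga S) X)
    have e : s ≫ fst (Ga S) X = q ≫ σ[Ga S] := by
      simp only [s, Category.assoc, whiskerRight_fst]
      rw [← Category.assoc]
      congr 1
      ext1 <;> simp [q]
    refine (DFunLike.congr_fun (comorphism_left_comp s (fst (Ga S) X)) (gaT S)).symm.trans ?_
    rw [e, comorphism_left_comp, RingHom.comp_apply, comorphism_ga_add, map_add,
      ← RingHom.comp_apply, ← RingHom.comp_apply, ← comorphism_left_comp, ← comorphism_left_comp,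
      lift_fst, lift_snd, comorphism_left_comp]
    rfl
  have hr := fun x j => h.coeff_of_comp_eq h₂ (continuous_comorphism r.left) hrp hrt j x
  have hs := fun x i j => h.coeff_coeff_of_var_add h₂ (continuous_comorphism s.left) hsp hst i j x
  rw [← Iso.inv_comp_eq, ← Category.assoc]
  change s ≫ γ = r ≫ γ ↔ _
  have key : s ≫ γ = r ≫ γ ↔ ∀ b, comorphism s.left (comorphism γ.left b) =
      comorphism r.left (comorphism γ.left b) := by
    refine ⟨fun e b => ?_, fun e => over_hom_ext ?_⟩
    · have := congrArg (fun f : Ga S ⊗ (Ga S ⊗ X) ⟶ X => comorphism f.left) e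
      simp only [comorphism_left_comp] at this
      exact DFunLike.congr_fun this b
    · exact (comorphism_left_comp s γ).trans
        ((RingHom.ext e).trans (comorphism_left_comp r γ).symm)
  rw [key]
  -- Two elements of the iterated series ring agree if and only if their coefficients at every tⁱ
  -- t₂ʲ agree. The index j is the outer one and i the inner one.
  refine ⟨fun e i j b => ?_, fun e b => h₂.ext fun j => h.ext fun i => ?_⟩
  · rw [← hs, ← hr, e]
  · rw [hs, hr, e]

lemma GaAction.coaction_injective :
    Function.Injective (GaAction.coaction : GaAction X → X.left.ring →+* (Ga S ⊗ X).left.ring) :=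
  fun μ ν h => AddModObj.ext μ ν (over_hom_ext h)

variable [Algebra S.ring X.left.ring]

/-- The condition on A expresses that the action is a morphism over S, since both the action and the
second projection respect the structure morphisms. -/
lemma GaAction.isCoaction (hX : comorphism X.hom = algebraMap S.ring X.left.ring)
    (μ : GaAction X) : (isRestrictedSeries X).IsCoaction S.ring μ.coaction where
  continuous := continuous_comorphism _
  comp_algebraMap := by
    rw [← hX]
    exact (comorphism_comp_hom μ.hom).trans (comorphism_comp_hom (snd (Ga S) X)).symm
  coeff_zero := (zero_vadd_iff μ.hom).1 μ.zero_vadd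
  coeff_coeff := (add_vadd_iff μ.hom).1 μ.add_vadd

/-- Compatibility of `f` with A is what makes the induced morphism one over S. The two axioms are
then the coefficient identities read backwards. -/
lemma exists_gaAction (hX : comorphism X.hom = algebraMap S.ring X.left.ring)
    {f : X.left.ring →+* (Ga S ⊗ X).left.ring}
    (hf : (isRestrictedSeries X).IsCoaction S.ring f) : ∃ μ : GaAction X, μ.coaction = f := by
  let v : (Ga S ⊗ X).left ⟶ X.left := ofRingHom f hf.continuous
  have hv : comorphism v = f := comorphism_ofRingHom f hf.continuous
  let γ : Ga S ⊗ X ⟶ X := Over.homMk v (hom_ext (by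
    rw [comorphism_comp, hv, hX, hf.comp_algebraMap, ← hX]
    exact comorphism_comp_hom (snd (Ga S) X)))
  have hγ : comorphism γ.left = f := hv
  refine ⟨⟨γ, (zero_vadd_iff γ).2 ?_, (add_vadd_iff γ).2 ?_⟩, hv⟩
  · rw [hγ]; exact hf.coeff_zero
  · rw [hγ]; exact hf.coeff_coeff

/-- Actions of the additive group correspond to topologically integrable iterated higher
derivations. -/
noncomputable def gaActionEquiv (hX : comorphism X.hom = algebraMap S.ring X.left.ring) :
    GaAction X ≃ TopIntHigherDerivation S.ring X.left.ring :=
  Equiv.ofBijective (fun μ => (μ.isCoaction hX).higherDerivation)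
    -- Equal derivations mean equal coefficients of the coactions, and these determine the coactions
    -- and hence the actions.
    ⟨fun μ ν e => GaAction.coaction_injective (RingHom.ext fun b => (isRestrictedSeries X).ext
      fun i => congrArg (fun D : TopIntHigherDerivation S.ring X.left.ring => D.D i b) e),
    fun D => by
      obtain ⟨f, hf, hD⟩ := (isRestrictedSeries X).exists_isCoaction D
      obtain ⟨μ, rfl⟩ := exists_gaAction hX hf
      exact ⟨μ, TopIntHigherDerivation.ext fun i b => hD i b⟩⟩

lemma hasSum_gaActionEquiv (hX : comorphism X.hom = algebraMap S.ring X.left.ring)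
    (μ : GaAction X) (b : X.left.ring) :
    HasSum (fun i => sndPullback X ((gaActionEquiv hX μ).D i b) * coordinate X ^ i)
      (μ.coaction b) :=
  (isRestrictedSeries X).hasSum_of_coeff fun _ => rfl

end AffIndScheme

theorem mainTheorem1 {A B : Type u} [CommRing A] [UniformSpace A] [CompleteTopRing A]
    [CommRing B] [UniformSpace B] [CompleteTopRing B] [Algebra A B]
    (hφ : Continuous (algebraMap A B)) :
    ∃ Φ : AffIndScheme.GaAction (AffIndScheme.overSpf hφ) ≃ TopIntHigherDerivation A B,
      (∀ (μ : AffIndScheme.GaAction (AffIndScheme.overSpf hφ)) (b : B),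
        HasSum
          (fun i : ℕ => AffIndScheme.sndPullback (AffIndScheme.overSpf hφ) ((Φ μ).D i b) *
            AffIndScheme.coordinate (AffIndScheme.overSpf hφ) ^ i)
          (μ.coaction b)) ∧
      ∀ [Algebra ℚ A], ∃ Ψ : TopIntHigherDerivation A B ≃ TopIntDerivation A B,
        ∀ (D : TopIntHigherDerivation A B) (b : B), (Ψ D).der b = D.D 1 b ∧
          ∀ n : ℕ, D.D n b = algebraMap ℚ A (1 / (n.factorial : ℚ)) • ((Ψ D).der)^[n] b := by
  -- The given algebra structure is placed on the rings of the ind-schemes. The next fact identifies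
  -- it with the comorphism of the structure morphism.
  let : Algebra (AffIndScheme.mk A).ring (AffIndScheme.overSpf hφ).left.ring := ‹Algebra A B›
  have hX : AffIndScheme.comorphism (AffIndScheme.overSpf hφ).hom = algebraMap A B :=
    AffIndScheme.comorphism_ofRingHom _ hφ
  refine ⟨AffIndScheme.gaActionEquiv (X := AffIndScheme.overSpf hφ) hX,
    fun μ b => AffIndScheme.hasSum_gaActionEquiv (X := AffIndScheme.overSpf hφ) hX μ b, ?_⟩
  intro _
  exact ⟨topIntHigherDerivationEquiv, fun D b => ⟨rfl, fun n =>
    (D.D_eq_dividedPow n b).trans (D.derivation.dividedPow_apply n b)⟩⟩
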